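/- Let $0<n\le K$ be integers, let $V$ be an $\mathbb R^n$-valued random vector with $\mathbb E\|V\|^2<\infty$ whose distribution has a support (the set of points all of whose neighbourhoods have positive probability) that linearly spans $\mathbb R^n$, and let $\ell_1\ge\dots\ge\ell_K>0$. Put $\Sigma_V=\mathbb E[VV^\top]$, with eigenvalues $\sigma_1\ge\dots\ge\sigma_n$ (counted with multiplicity). A dictionary is a family $d_1,\dots,d_K\in\mathbb R^n$ with $\langle d_i,d_i\rangle=\ell_i$ for all $i$. Consider the $\ell_2$-optimal dictionary problem $$\text{minimise }\ \mathbb E\,\langle f(V),f(V)\rangle$$ over all dictionaries $(d_i)_{i=1}^K$ with $\operatorname{span}(d_i)_{i=1}^K=\mathbb R^n$ and all measurable schemes $f:\mathbb R^n\to\mathbb R^K$ with $(d_1\ \cdots\ d_K)f(V)=V$ almost surely. A dictionary is called $\ell_2$-optimal if it is part of an optimal pair $\big((d_i)_{i=1}^K,f\big)$. Put $\ell'_i=\ell_i$ for $1\le i\le n-1$ and $\ell'_n=\sum_{j=n}^K\ell_j$. Then the quadratic program $$\text{minimise }\ \sum_{t=1}^n\big(\ell'_t x_t^2-2\sqrt{\sigma_t}\,x_t\big)\quad\text{subject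 to}\quad 0\le x_1\le\dots\le x_n$$ has a unique optimal solution $x^*=(x_t^*)_{t=1}^n$. Let $q^*$ be its optimal value. Let $n_1=1$ and, as long as the set is non-empty, $n_l=\min\{t : n_{l-1}<t\le n,\ x^*_{t-1}<x^*_t\}$; let $n_1<\dots<n_T$ be the numbers obtained, put $n_{T+1}=n+1$, and define $$\lambda_i^*=\sqrt{\sigma_i}\;\frac{\sum_{j=n_l}^{n_{l+1}-1}\ell'_j}{\sum_{j=n_l}^{n_{l+1}-1}\sqrt{\sigma_j}}\quad(n_l\le i<n_{l+1},\ 1\le l\le T),\qquad J=\sum_{l=1}^T\frac{\Big(\sum_{j=n_l}^{n_{l+1}-1}\sqrt{\sigma_j}\Big)^2}{\sum_{j=n_l}^{n_{l+1}-1}\ell'_j}.$$ The sequence $(\lambda_i^*)_{i=1}^n$ is positive and non-increasing, and: (i) The $\ell_2$-optimal dictionary problem has an optimal solution. (ii) A dictionary $(d_i)_{i=1}^K$ is $\ell_2$-optimal if and only if $\sum_{i=1}^K d_id_i^\top=\sum_{i=1}^n\lambda_i^*u_iu_i^\top$ for some orthonormal vectors $u_1,\dots,u_n$ with $\Sigma_Vu_i=\sigma_iu_i$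 for all $i$. (iii) If $(d_i)_{i=1}^K$ is an $\ell_2$-optimal dictionary, then $f^*(v)=(d_1\ \cdots\ d_K)^+v$, where $^+$ is the Moore–Penrose pseudo-inverse, is an optimal scheme for it, and every optimal scheme $f$ for it satisfies $f(V)=f^*(V)$ almost surely. (iv) The optimal value of the $\ell_2$-optimal dictionary problem is $p^*=J=-q^*$. -/

import Mathlib

open MeasureTheory

noncomputable section

namespace L2Dict

/-! ### Moore-Penrose pseudo-inverse -/

/-- `B` is the Moore-Penrose pseudo-inverse of the real matrix `A` (the four Penrose conditions). -/
structure IsPseudoInverse {m k : ℕ} (A : Matrix (Fin m) (Fin k) ℝ)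
    (B : Matrix (Fin k) (Fin m) ℝ) : Prop where
  mul_mul_left : A * B * A = A
  mul_mul_right : B * A * B = B
  symm_left : (A * B).transpose = A * B
  symm_right : (B * A).transpose = B * A

/-- A matrix has at most one Moore-Penrose pseudo-inverse. -/
theorem IsPseudoInverse.unique {m k : ℕ} {A : Matrix (Fin m) (Fin k) ℝ}
    {B C : Matrix (Fin k) (Fin m) ℝ} (hB : IsPseudoInverse A B) (hC : IsPseudoInverse A C) :
    B = C := by
  have h1 : A * B = A * C := by
    have : (A * C) * (A * B) = A * B := by rw [← Matrix.mul_assoc, hC.mul_mul_left]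
    have h2 := congrArg Matrix.transpose this
    rw [Matrix.transpose_mul, hB.symm_left, hC.symm_left, ← Matrix.mul_assoc,
      hB.mul_mul_left] at h2
    exact h2.symm
  have h2 : B * A = C * A := by
    have : (B * A) * (C * A) = B * A := by
      rw [Matrix.mul_assoc, ← Matrix.mul_assoc A, hC.mul_mul_left]
    have h3 := congrArg Matrix.transpose this
    rw [Matrix.transpose_mul, hB.symm_right, hC.symm_right, Matrix.mul_assoc,
      ← Matrix.mul_assoc A, hB.mul_mul_left] at h3
    exact h3.symm
  rw [← hB.mul_mul_right, h2, Matrix.mul_assoc, h1, ← Matrix.mul_assoc, hC.mul_mul_right]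

/-! ### The maps `λ` and `J` of a pair of sequences and a partition into blocks

Indices are counted from `0`. A partition of `{0, …, m - 1}` into `T` consecutive blocks is given
by starting points `p 0 ≤ ⋯ ≤ p (T - 1)` with `p 0 = 0` and the end marker `p T = m`; block `l`
is `{j | p l ≤ j < p (l + 1)}`. -/

/-- `∑_{p l ≤ j < p (l + 1)} a j`. -/
def blockSum {m : ℕ} (a : Fin m → ℝ) (p : ℕ → ℕ) (l : ℕ) : ℝ :=
  ∑ j ∈ Finset.univ.filter (fun j : Fin m => p l ≤ (j : ℕ) ∧ (j : ℕ) < p (l + 1)), a j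

/-- `λ(c, a, p)_i = c i * (∑ a / ∑ c)`, the sums being over the block that contains `i`
(the outer sum has exactly one nonzero term, that of the block of `i`). -/
def lambdaMap {m : ℕ} (c a : Fin m → ℝ) (T : ℕ) (p : ℕ → ℕ) (i : Fin m) : ℝ :=
  ∑ l ∈ Finset.range T,
    if p l ≤ (i : ℕ) ∧ (i : ℕ) < p (l + 1) then c i * (blockSum a p l / blockSum c p l) else 0

/-- `J(c, a, p) = ∑_l (∑ c)² / ∑ a`, the inner sums being over block `l`. -/
def JMap {m : ℕ} (c a : Fin m → ℝ) (T : ℕ) (p : ℕ → ℕ) : ℝ :=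
  ∑ l ∈ Finset.range T, blockSum c p l ^ 2 / blockSum a p l

/-- The starting points of the blocks on which the sequence `x` is constant: the first is `0`, and
the next one is the least `t > p l` in `{0, …, m - 1}` with `x (t - 1) < x t`, or the end
marker `m` if there is no such `t`. -/
def breakSeq {m : ℕ} (x : Fin m → ℝ) : ℕ → ℕ
  | 0 => 0
  | l + 1 => sInf ({t : ℕ | breakSeq x l < t ∧
      ∃ h : t < m, x ⟨t - 1, lt_of_le_of_lt (Nat.sub_le t 1) h⟩ < x ⟨t, h⟩} ∪ {m})

/-- The number `T` of blocks: the first position at which the end marker is reached. -/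
def numBlocks {m : ℕ} (x : Fin m → ℝ) : ℕ := sInf {l : ℕ | breakSeq x l = m}

/-! ### The monotone quadratic program -/

/-- `∑_t (a t * x t ^ 2 - 2 * √(s t) * x t)`. -/
def qpObjective {m : ℕ} (a s x : Fin m → ℝ) : ℝ :=
  ∑ t, (a t * x t ^ 2 - 2 * √(s t) * x t)

/-- The constraint `0 ≤ x 0 ≤ x 1 ≤ ⋯ ≤ x (m - 1)`. -/
def QPFeasible {m : ℕ} (x : Fin m → ℝ) : Prop := (∀ t, 0 ≤ x t) ∧ Monotone x

/-- `x` is an optimal solution of the quadratic program. -/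
def IsQPSolution {m : ℕ} (a s x : Fin m → ℝ) : Prop :=
  QPFeasible x ∧ ∀ y : Fin m → ℝ, QPFeasible y → qpObjective a s x ≤ qpObjective a s y

/-! ### The second moment matrix and its eigenvalues -/

section Moments

variable {Ω : Type*} [MeasurableSpace Ω] {n : ℕ}

/-- `Σ_V = E[V Vᵀ]`. -/
def secondMoment (μ : Measure Ω) (V : Ω → EuclideanSpace ℝ (Fin n)) :
    Matrix (Fin n) (Fin n) ℝ :=
  Matrix.of fun i j => ∫ ω, V ω i * V ω j ∂μ

theorem secondMoment_isHermitian (μ : Measure Ω) (V : Ω → EuclideanSpace ℝ (Fin n)) :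
    (secondMoment μ V).IsHermitian := by
  ext i j
  simp [secondMoment, mul_comm]

/-- The eigenvalues of `Σ_V` with multiplicity, in non-increasing order. -/
def sigmaEig (μ : Measure Ω) (V : Ω → EuclideanSpace ℝ (Fin n)) (i : Fin n) : ℝ :=
  (secondMoment_isHermitian μ V).eigenvalues₀ (Fin.cast (Fintype.card_fin n).symm i)

end Moments

/-! ### Dictionaries, schemes and the optimisation problem -/

/-- `ℓ'_i = ℓ_i` for every `i` but the last one of `{0, …, n - 1}`, and the last entry of `ℓ'` is
the sum of all `ℓ_j` with `n - 1 ≤ j`. -/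
def foldedLengths {n K : ℕ} (hnK : n ≤ K) (ℓ : Fin K → ℝ) (i : Fin n) : ℝ :=
  if (i : ℕ) + 1 < n then ℓ (Fin.castLE hnK i)
  else ∑ j ∈ Finset.univ.filter (fun j : Fin K => (i : ℕ) ≤ (j : ℕ)), ℓ j

/-- The matrix `(d_1 ⋯ d_K)` whose columns are the dictionary vectors. -/
def dictMatrix {n K : ℕ} (d : Fin K → EuclideanSpace ℝ (Fin n)) : Matrix (Fin n) (Fin K) ℝ :=
  Matrix.of fun a i => d i a

/-- The linear map `v ↦ A v` between Euclidean spaces. -/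
def matScheme {n K : ℕ} (A : Matrix (Fin K) (Fin n) ℝ) (v : EuclideanSpace ℝ (Fin n)) :
    EuclideanSpace ℝ (Fin K) :=
  WithLp.toLp 2 (A.mulVec v.ofLp)

/-- The rank-one matrix `v vᵀ`. -/
def outer {n : ℕ} (v : EuclideanSpace ℝ (Fin n)) : Matrix (Fin n) (Fin n) ℝ :=
  Matrix.vecMulVec v.ofLp v.ofLp

/-- A dictionary with prescribed squared lengths: `⟨d_i, d_i⟩ = ℓ_i` for all `i`. -/
def IsDictionary {n K : ℕ} (ℓ : Fin K → ℝ) (d : Fin K → EuclideanSpace ℝ (Fin n)) : Prop :=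
  ∀ i, inner ℝ (d i) (d i) = ℓ i

section Problem

variable {Ω : Type*} [MeasurableSpace Ω] {n K : ℕ}

/-- Feasibility of a dictionary `d` and a scheme of representation `f`: prescribed lengths, `d`
spans the whole space, and `f` is a (measurable) map with `(d_1 ⋯ d_K) f(V) = V` almost surely. -/
structure IsFeasible (μ : Measure Ω) (V : Ω → EuclideanSpace ℝ (Fin n)) (ℓ : Fin K → ℝ)
    (d : Fin K → EuclideanSpace ℝ (Fin n))
    (f : EuclideanSpace ℝ (Fin n) → EuclideanSpace ℝ (Fin K)) : Prop where
  lengths : IsDictionary ℓ d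
  span_eq_top : Submodule.span ℝ (Set.range d) = ⊤
  aemeasurable : AEMeasurable f (μ.map V)
  represents : ∀ᵐ ω ∂μ, ∑ i, f (V ω) i • d i = V ω

/-- The average cost `E[⟨f(V), f(V)⟩]`, possibly infinite. -/
def cost (μ : Measure Ω) (V : Ω → EuclideanSpace ℝ (Fin n))
    (f : EuclideanSpace ℝ (Fin n) → EuclideanSpace ℝ (Fin K)) : ENNReal :=
  ∫⁻ ω, ENNReal.ofReal (inner ℝ (f (V ω)) (f (V ω))) ∂μ

/-- The set of costs of the feasible pairs; the optimal value is its infimum. -/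
def feasibleCosts (μ : Measure Ω) (V : Ω → EuclideanSpace ℝ (Fin n)) (ℓ : Fin K → ℝ) :
    Set ENNReal :=
  {r | ∃ d f, IsFeasible μ V ℓ d f ∧ cost μ V f = r}

/-- `(d, f)` is an optimal solution of the `ℓ₂`-optimal dictionary problem. -/
def IsOptimal (μ : Measure Ω) (V : Ω → EuclideanSpace ℝ (Fin n)) (ℓ : Fin K → ℝ)
    (d : Fin K → EuclideanSpace ℝ (Fin n))
    (f : EuclideanSpace ℝ (Fin n) → EuclideanSpace ℝ (Fin K)) : Prop :=
  IsFeasible μ V ℓ d f ∧ ∀ d' f', IsFeasible μ V ℓ d' f' → cost μ V f ≤ cost μ V f'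

/-- `d` is an `ℓ₂`-optimal dictionary: it is part of an optimal solution. -/
def IsOptimalDictionary (μ : Measure Ω) (V : Ω → EuclideanSpace ℝ (Fin n)) (ℓ : Fin K → ℝ)
    (d : Fin K → EuclideanSpace ℝ (Fin n)) : Prop :=
  ∃ f, IsOptimal μ V ℓ d f

end Problem

end L2Dict

end

namespace L2Dict


/-! ### The quadratic program -/

section QP

variable {m : ℕ} {a s x : Fin m → ℝ}

/-! For a spanning dictionary with frame operator `S = ∑ dᵢdᵢᵀ = ∑ λₜ vₜvₜᵀ`, the cheapest
representation of `v` is the pseudo-inverse one, of cost `vᵀS⁻¹v`; any other scheme costs more by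
the mean square of its deviation (`exists_pseudoInverse`, `cost_eq_add`). So the problem is to
minimise `tr(S⁻¹Σ_V)` over the attainable frame operators. By Ky Fan's inequality the decreasing
spectrum of `S` has tails bounded by those of `ℓ'` (`tail_le_of_frame`, `tail_foldedLengths`).
Conversely, every positive sequence with such tails and the right total is realised, by rotating
pairs of vectors (`exists_frame_of_majorized`).

The solution `x` of the quadratic program acts as a system of multipliers. Completing squares
(`trace_decomposition`) writes the trace as `∑ √σₜ xₜ` plus three non-negative terms: a sum of
squares, a pairing of `x` with the gap between the diagonal of `√Σ_V` in the basis `v` and its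
spectrum, and a pairing of `x²` with `ℓ' - λ`. The pairings are non-negative by Abel summation,
since `x` is monotone and the tails have the right sign. The bound is attained at `λ = √σ / x` with
common eigenvectors. First-order optimality of `x`, tested along suitable directions, shows that
this `λ` is attainable and that `x` equals `∑ √σ / ∑ ℓ'` on each of its level blocks, which gives
the closed forms of `λ*` and `J`. Equality forces these eigenvalues and makes `v` diagonalise `Σ_V`
in the right order (`eq_of_trace_le`). -/

theorem exists_isQPSolution (ha : ∀ t, 0 < a t) : ∃ x, IsQPSolution a s x := by
  -- Beyond `B`, which dominates every unconstrained minimiser `√(s t) / a t`, each summand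
  -- increases. Truncating at `B` keeps feasibility and does not raise the objective, so a compact
  -- set suffices.
  set B : ℝ := ∑ t, √(s t) / a t with hB
  have hBt : ∀ t, √(s t) / a t ≤ B := fun t =>
    Finset.single_le_sum (f := fun t => √(s t) / a t)
      (fun i _ => div_nonneg (Real.sqrt_nonneg _) (ha i).le) (Finset.mem_univ t)
  have hB0 : 0 ≤ B := Finset.sum_nonneg fun i _ => div_nonneg (Real.sqrt_nonneg _) (ha i).le
  set C : Set (Fin m → ℝ) := Set.Icc 0 (fun _ => B) ∩ {y | Monotone y} with hC
  have hclosed : IsClosed {y : Fin m → ℝ | Monotone y} := isClosed_monotone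
  have hcpt : IsCompact C := isCompact_Icc.inter_right hclosed
  have hne : C.Nonempty := ⟨0, ⟨⟨le_rfl, fun _ => hB0⟩, monotone_const⟩⟩
  have hcont : Continuous (qpObjective a s) := by
    unfold qpObjective
    fun_prop
  obtain ⟨x, hx, hmin⟩ := hcpt.exists_isMinOn hne hcont.continuousOn
  refine ⟨x, ⟨fun t => hx.1.1 t, hx.2⟩, fun y hy => ?_⟩
  have hy' : (fun t => min (y t) B) ∈ C :=
    ⟨⟨fun t => le_min (hy.1 t) hB0, fun t => min_le_right _ _⟩,
      fun i j hij => min_le_min_right _ (hy.2 hij)⟩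
  refine (hmin hy').trans (Finset.sum_le_sum fun t _ => ?_)
  rcases le_total (y t) B with h | h
  · simp [h]
  · simp only [min_eq_right h]
    have h1 : √(s t) ≤ a t * B := by
      have := hBt t
      rwa [div_le_iff₀ (ha t), mul_comm] at this
    have h2 : a t * B ≤ a t * y t := mul_le_mul_of_nonneg_left h (ha t).le
    nlinarith

/-- Strict convexity: at the midpoint of two solutions the objective drops by a weighted square of
their distance. -/
theorem IsQPSolution.unique (ha : ∀ t, 0 < a t) {y : Fin m → ℝ} (hx : IsQPSolution a s x)
    (hy : IsQPSolution a s y) : y = x := by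
  set z : Fin m → ℝ := fun t => (x t + y t) / 2
  have hz : QPFeasible z :=
    ⟨fun t => div_nonneg (add_nonneg (hx.1.1 t) (hy.1.1 t)) zero_le_two, fun i j hij => by
      have h1 := hx.1.2 hij
      have h2 := hy.1.2 hij
      simp only [z]; linarith⟩
  have key : qpObjective a s z =
      (qpObjective a s x + qpObjective a s y) / 2 - ∑ t, a t * (x t - y t) ^ 2 / 4 := by
    simp only [qpObjective, ← Finset.sum_add_distrib, Finset.sum_div, ← Finset.sum_sub_distrib]
    refine Finset.sum_congr rfl fun t _ => ?_
    simp only [z]; ring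
  have h1 := hx.2 z hz
  have h2 := hy.2 z hz
  have hnn : ∀ t ∈ Finset.univ, 0 ≤ a t * (x t - y t) ^ 2 / 4 := fun t _ => by
    have := ha t
    positivity
  have h0 : ∑ t, a t * (x t - y t) ^ 2 / 4 = 0 :=
    le_antisymm (by linarith) (Finset.sum_nonneg hnn)
  funext t
  have := (Finset.sum_eq_zero_iff_of_nonneg hnn).1 h0 t (Finset.mem_univ t)
  have h3 : (x t - y t) ^ 2 = 0 := by
    have := ha t
    nlinarith
  have := pow_eq_zero_iff (two_ne_zero) |>.1 h3
  linarith

/-- Raising all coordinates below a small level `ε` up to `ε` keeps the order, and it strictly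
lowers the objective if `ε` lies below every unconstrained minimiser `√(s t) / a t`. -/
theorem IsQPSolution.pos (ha : ∀ t, 0 < a t) (hs : ∀ t, 0 < s t) (hx : IsQPSolution a s x)
    (t : Fin m) : 0 < x t := by
  have : Nonempty (Fin m) := ⟨t⟩
  obtain ⟨i, hi⟩ := Finite.exists_min fun t => √(s t) / a t
  set ε := √(s i) / a i / 2
  have hipos : 0 < √(s i) / a i := div_pos (Real.sqrt_pos.2 (hs i)) (ha i)
  have hε : 0 < ε := half_pos hipos
  have hlt : ∀ t, a t * ε < √(s t) := fun t => by
    have h1 : ε < √(s t) / a t := (half_lt_self hipos).trans_le (hi t)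
    rwa [lt_div_iff₀ (ha t), mul_comm] at h1
  by_contra hxt
  have hlt' : x t < ε := (not_lt.1 hxt).trans_lt hε
  have hfe : QPFeasible fun t => max (x t) ε :=
    ⟨fun t => hε.le.trans (le_max_right _ _), fun i j hij => max_le_max_right _ (hx.1.2 hij)⟩
  refine absurd (hx.2 _ hfe) (not_le.2 (Finset.sum_lt_sum (fun u _ => ?_)
    ⟨t, Finset.mem_univ t, ?_⟩))
  · rcases le_total ε (x u) with h | h
    · simp [h]
    · simp only [max_eq_right h]
      have := hlt u
      have h2 : a u * x u ≤ a u * ε := mul_le_mul_of_nonneg_left h (ha u).le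
      nlinarith
  · simp only [max_eq_right hlt'.le]
    have := hlt t
    have h2 : a t * x t < a t * ε := mul_lt_mul_of_pos_left hlt' (ha t)
    nlinarith

/-- First-order optimality of a solution, tested along directions that keep the order of the
coordinates of `x`. -/
theorem IsQPSolution.variational (hpos : ∀ t, 0 < x t)
    (hx : IsQPSolution a s x) (e : Fin m → ℝ) (he : ∀ i j, i ≤ j → x i = x j → e i ≤ e j) :
    0 ≤ ∑ t, (a t * x t - √(s t)) * e t := by
  -- Positivity and the strict gaps of `x` survive a small step; only pairs with equal coordinates
  -- constrain `e`.
  have hev : ∀ᶠ ε : ℝ in nhdsWithin 0 (Set.Ioi 0), QPFeasible fun t => x t + ε * e t := by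
    have h1 : ∀ᶠ ε : ℝ in nhdsWithin 0 (Set.Ioi 0), ∀ t, 0 ≤ x t + ε * e t := by
      refine Filter.eventually_all.2 fun t => Filter.Eventually.filter_mono nhdsWithin_le_nhds ?_
      have : Filter.Tendsto (fun ε : ℝ => x t + ε * e t) (nhds 0) (nhds (x t + 0 * e t)) :=
        Continuous.tendsto (by fun_prop) 0
      rw [zero_mul, add_zero] at this
      exact (this.eventually (lt_mem_nhds (hpos t))).mono fun _ h => h.le
    have h2 : ∀ᶠ ε : ℝ in nhdsWithin 0 (Set.Ioi 0), ∀ i j, i ≤ j →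
        x i + ε * e i ≤ x j + ε * e j := by
      refine Filter.eventually_all.2 fun i => Filter.eventually_all.2 fun j => ?_
      by_cases hij : i ≤ j
      · rcases (hx.1.2 hij).eq_or_lt with h | h
        · filter_upwards [self_mem_nhdsWithin] with ε hε _
          rw [h]
          have := mul_le_mul_of_nonneg_left (he i j hij h) (le_of_lt hε)
          linarith
        · refine Filter.Eventually.filter_mono nhdsWithin_le_nhds ?_
          have : Filter.Tendsto (fun ε : ℝ => (x j + ε * e j) - (x i + ε * e i)) (nhds 0)
              (nhds ((x j + 0 * e j) - (x i + 0 * e i))) :=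
            Continuous.tendsto (by fun_prop) 0
          rw [zero_mul, add_zero, zero_mul, add_zero] at this
          exact (this.eventually (lt_mem_nhds (sub_pos.2 h))).mono fun _ h _ => by linarith
      · exact Filter.Eventually.of_forall fun _ h => absurd h hij
    filter_upwards [h1, h2] with ε h1 h2
    exact ⟨h1, fun i j hij => h2 i j hij⟩
  have hineq : ∀ᶠ ε : ℝ in nhdsWithin 0 (Set.Ioi 0),
      0 ≤ 2 * ∑ t, (a t * x t - √(s t)) * e t + ε * ∑ t, a t * e t ^ 2 := by
    filter_upwards [hev, self_mem_nhdsWithin] with ε hf hε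
    have h := hx.2 _ hf
    have key : qpObjective a s (fun t => x t + ε * e t) = qpObjective a s x +
        ε * (2 * ∑ t, (a t * x t - √(s t)) * e t + ε * ∑ t, a t * e t ^ 2) := by
      simp only [qpObjective, Finset.mul_sum, ← Finset.sum_add_distrib]
      refine Finset.sum_congr rfl fun t _ => ?_
      ring
    rw [key] at h
    exact nonneg_of_mul_nonneg_right (by linarith) hε
  have hlim : Filter.Tendsto (fun ε : ℝ => 2 * ∑ t, (a t * x t - √(s t)) * e t +
      ε * ∑ t, a t * e t ^ 2) (nhdsWithin 0 (Set.Ioi 0))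
      (nhds (2 * ∑ t, (a t * x t - √(s t)) * e t + 0 * ∑ t, a t * e t ^ 2)) :=
    (Continuous.tendsto (by fun_prop) 0).mono_left nhdsWithin_le_nhds
  have := ge_of_tendsto hlim hineq
  linarith

/-- If `e` is constant on the level sets of `x`, both `e` and `-e` are admissible directions. -/
theorem IsQPSolution.variational_eq (hpos : ∀ t, 0 < x t)
    (hx : IsQPSolution a s x) (e : Fin m → ℝ) (he : ∀ i j, x i = x j → e i = e j) :
    ∑ t, (a t * x t - √(s t)) * e t = 0 := by
  have h1 := hx.variational hpos e fun i j _ h => (he i j h).le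
  have h2 := hx.variational hpos (-e) fun i j _ h => neg_le_neg (he i j h).ge
  simp only [Pi.neg_apply, mul_neg, Finset.sum_neg_distrib] at h2
  linarith

theorem IsQPSolution.sum_sq_eq (hpos : ∀ t, 0 < x t) (hx : IsQPSolution a s x) :
    ∑ t, a t * x t ^ 2 = ∑ t, √(s t) * x t := by
  have h := hx.variational_eq hpos x fun _ _ h => h
  rw [← sub_eq_zero, ← Finset.sum_sub_distrib, ← h]
  exact Finset.sum_congr rfl fun t _ => by ring

theorem IsQPSolution.qpObjective_eq (hpos : ∀ t, 0 < x t) (hx : IsQPSolution a s x) :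
    qpObjective a s x = -∑ t, √(s t) * x t := by
  have h : qpObjective a s x = ∑ t, a t * x t ^ 2 - 2 * ∑ t, √(s t) * x t := by
    rw [Finset.mul_sum, ← Finset.sum_sub_distrib]
    exact Finset.sum_congr rfl fun t _ => by ring
  rw [h, hx.sum_sq_eq hpos]
  ring

/-- The sequence `√s / x` dominates `a` in the sense of majorization: tails. -/
theorem IsQPSolution.tail_le (hpos : ∀ t, 0 < x t) (hx : IsQPSolution a s x) (k : ℕ) :
    ∑ t with k ≤ (t : Fin m).val, √(s t) / x t ≤ ∑ t with k ≤ (t : Fin m).val, a t := by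
  -- On a level set of `x` the truncated reciprocal is a step from zero up to a positive constant,
  -- hence admissible; the factor `(x t)⁻¹` turns `a t * x t - √(s t)` into `a t - √(s t) / x t`.
  have h := hx.variational hpos (fun t => if k ≤ t.val then (x t)⁻¹ else 0) fun i j hij h => by
    have := hpos j
    rw [h]
    split_ifs with h1 h2
    · rfl
    · exact absurd (h1.trans hij) h2
    · positivity
    · rfl
  rw [← sub_nonneg, ← Finset.sum_sub_distrib]
  refine h.trans_eq ?_
  rw [Finset.sum_filter]
  refine Finset.sum_congr rfl fun t _ => ?_
  have := hpos t
  split_ifs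
  · field_simp
  · simp

theorem IsQPSolution.total_eq (hpos : ∀ t, 0 < x t) (hx : IsQPSolution a s x) :
    ∑ t, √(s t) / x t = ∑ t, a t := by
  have h := hx.variational_eq hpos (fun t => (x t)⁻¹) fun i j h => by rw [h]
  rw [eq_comm, ← sub_eq_zero, ← Finset.sum_sub_distrib, ← h]
  refine Finset.sum_congr rfl fun t _ => ?_
  have := hpos t
  field_simp

end QP

/-! ### Blocks -/

section Blocks

variable {m : ℕ} {x : Fin m → ℝ}

theorem breakSeq_le (x : Fin m → ℝ) : ∀ l, breakSeq x l ≤ m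
  | 0 => Nat.zero_le _
  | l + 1 => by
    rw [breakSeq]
    exact Nat.sInf_le (Or.inr rfl)

theorem breakSeq_succ_mem (x : Fin m → ℝ) (l : ℕ) :
    breakSeq x (l + 1) ∈ ({t : ℕ | breakSeq x l < t ∧
      ∃ h : t < m, x ⟨t - 1, lt_of_le_of_lt (Nat.sub_le t 1) h⟩ < x ⟨t, h⟩} ∪ {m}) := by
  rw [breakSeq]
  exact Nat.sInf_mem ⟨m, Or.inr rfl⟩

theorem breakSeq_lt_succ (x : Fin m → ℝ) {l : ℕ} (h : breakSeq x l < m) :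
    breakSeq x l < breakSeq x (l + 1) := by
  rcases breakSeq_succ_mem x l with h1 | h1
  · exact h1.1
  · rw [Set.mem_singleton_iff.1 h1]
    exact h

theorem breakSeq_mono (x : Fin m → ℝ) : Monotone (breakSeq x) := by
  refine monotone_nat_of_le_succ fun l => ?_
  rcases breakSeq_succ_mem x l with h1 | h1
  · exact h1.1.le
  · rw [Set.mem_singleton_iff.1 h1]
    exact breakSeq_le x l

theorem exists_breakSeq_eq (x : Fin m → ℝ) : ∃ l, breakSeq x l = m := by
  by_contra! h
  have h1 : ∀ l, breakSeq x l < m := fun l => lt_of_le_of_ne (breakSeq_le x l) (h l)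
  have h2 : StrictMono (breakSeq x) := strictMono_nat_of_lt_succ fun l => breakSeq_lt_succ x (h1 l)
  -- A strictly increasing sequence of naturals would satisfy `m ≤ breakSeq x m`.
  exact absurd (h2.le_apply (x := m)) (not_le.2 (h1 m))

theorem breakSeq_numBlocks (x : Fin m → ℝ) : breakSeq x (numBlocks x) = m :=
  Nat.sInf_mem (s := {l | breakSeq x l = m}) (exists_breakSeq_eq x)

theorem breakSeq_lt_of_lt (x : Fin m → ℝ) {l : ℕ} (h : l < numBlocks x) : breakSeq x l < m :=
  lt_of_le_of_ne (breakSeq_le x l) fun h' =>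
    Nat.notMem_of_lt_sInf (s := {l | breakSeq x l = m}) h h'

theorem exists_block (x : Fin m → ℝ) (i : Fin m) : ∃ l < numBlocks x,
    breakSeq x l ≤ i.val ∧ i.val < breakSeq x (l + 1) := by
  classical
  have hex : ∃ l, i.val < breakSeq x l := ⟨_, by rw [breakSeq_numBlocks]; exact i.2⟩
  -- The first break beyond `i` is not the zeroth, because `breakSeq x 0 = 0`; its predecessor
  -- starts the block of `i`.
  obtain ⟨l, hl⟩ : ∃ l, Nat.find hex = l + 1 := Nat.exists_eq_succ_of_ne_zero fun h => by
    have := Nat.find_spec hex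
    rw [h] at this
    exact absurd this (Nat.not_lt_zero _)
  refine ⟨l, ?_, ?_, ?_⟩
  · have : Nat.find hex ≤ numBlocks x :=
      Nat.find_min' hex (by rw [breakSeq_numBlocks]; exact i.2)
    omega
  · exact not_lt.1 (Nat.find_min hex (by omega))
  · rw [← hl]
    exact Nat.find_spec hex

theorem block_unique (x : Fin m → ℝ) {i l k : ℕ} (hl : breakSeq x l ≤ i ∧ i < breakSeq x (l + 1))
    (hk : breakSeq x k ≤ i ∧ i < breakSeq x (k + 1)) : l = k := by
  rcases lt_trichotomy l k with h | h | h
  · have := breakSeq_mono x (Nat.succ_le_of_lt h)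
    simp only [Nat.succ_eq_add_one] at this
    omega
  · exact h
  · have := breakSeq_mono x (Nat.succ_le_of_lt h)
    simp only [Nat.succ_eq_add_one] at this
    omega

theorem eq_breakSeq (hx : Monotone x) {l : ℕ} {i : ℕ} (hi : i < m) (hl : breakSeq x l ≤ i)
    (hu : i < breakSeq x (l + 1)) : x ⟨i, hi⟩ = x ⟨breakSeq x l, hl.trans_lt hi⟩ := by
  induction i, hl using Nat.le_induction with
  | base => rfl
  | succ i hle ih =>
    rw [← ih (by omega) (by omega)]
    refine le_antisymm (not_lt.1 fun hlt => ?_) (hx (by simp))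
    -- A jump inside the block would be an earlier candidate for the next break.
    rw [breakSeq] at hu
    refine absurd (Nat.sInf_le (Or.inl ⟨Nat.lt_succ_of_le hle, hi, ?_⟩)) (not_le.2 hu)
    simpa using hlt

/-- Blocks are exactly level sets: `x` is constant on a block and jumps strictly where the next one
starts, so by monotonicity different blocks carry different values. This lets variational directions
isolate a block. -/
theorem mem_block_iff (hx : Monotone x) {l : ℕ} (hl : l < numBlocks x) (i : Fin m) :
    (breakSeq x l ≤ i.val ∧ i.val < breakSeq x (l + 1)) ↔
      x i = x ⟨breakSeq x l, breakSeq_lt_of_lt x hl⟩ := by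
  refine ⟨fun h => eq_breakSeq hx i.2 h.1 h.2, fun h => ?_⟩
  have key : ∀ {k : ℕ} (hk : k < numBlocks x) (j : Fin m), breakSeq x (k + 1) ≤ j.val →
      x ⟨breakSeq x k, breakSeq_lt_of_lt x hk⟩ < x j := by
    intro k hk j hj
    rcases breakSeq_succ_mem x k with ⟨h1, h2, h3⟩ | h1
    · exact ((hx (by rw [Fin.le_def]; dsimp only; omega)).trans_lt h3).trans_le (hx hj)
    · rw [Set.mem_singleton_iff.1 h1] at hj
      exact absurd j.2 (not_lt.2 hj)
  obtain ⟨k, hk, hk1, hk2⟩ := exists_block x i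
  have hik := eq_breakSeq hx i.2 hk1 hk2
  rcases lt_trichotomy k l with hkl | rfl | hkl
  · have := key hk ⟨breakSeq x l, breakSeq_lt_of_lt x hl⟩ (breakSeq_mono x hkl)
    rw [← hik, ← h] at this
    exact absurd this (lt_irrefl _)
  · exact ⟨hk1, hk2⟩
  · have := key hl ⟨breakSeq x k, breakSeq_lt_of_lt x hk⟩ (breakSeq_mono x hkl)
    rw [← hik, ← h] at this
    exact absurd this (lt_irrefl _)

end Blocks

/-! ### Closed forms on the level blocks of the solution -/

section BlockFormulas

variable {m : ℕ} {a s x : Fin m → ℝ}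

/-- Stationarity along the indicator of one level set: the value of `x` there is the ratio of the
block sums. -/
theorem IsQPSolution.blockSum_eq (hpos : ∀ t, 0 < x t) (hx : IsQPSolution a s x) {l : ℕ}
    (hl : l < numBlocks x) :
    blockSum (fun i => √(s i)) (breakSeq x) l =
      x ⟨breakSeq x l, breakSeq_lt_of_lt x hl⟩ * blockSum a (breakSeq x) l := by
  have h := hx.variational_eq hpos
    (fun t => if x t = x ⟨breakSeq x l, breakSeq_lt_of_lt x hl⟩ then 1 else 0)
    fun i j h => by simp only [h]
  simp only [blockSum, mem_block_iff hx.1.2 hl]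
  rw [eq_comm, ← sub_eq_zero, Finset.mul_sum, ← Finset.sum_sub_distrib, ← h, Finset.sum_filter]
  refine Finset.sum_congr rfl fun t _ => ?_
  split_ifs with ht
  · rw [ht]; ring
  · simp

theorem blockSum_pos (ha : ∀ t, 0 < a t) {l : ℕ} (hl : l < numBlocks x) :
    0 < blockSum a (breakSeq x) l := by
  refine Finset.sum_pos (fun t _ => ha t) ⟨⟨breakSeq x l, breakSeq_lt_of_lt x hl⟩, ?_⟩
  simpa using breakSeq_lt_succ x (breakSeq_lt_of_lt x hl)

theorem IsQPSolution.lambdaMap_eq (ha : ∀ t, 0 < a t) (hpos : ∀ t, 0 < x t)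
    (hx : IsQPSolution a s x) (i : Fin m) :
    lambdaMap (fun i => √(s i)) a (numBlocks x) (breakSeq x) i = √(s i) / x i := by
  obtain ⟨l, hl, hi⟩ := exists_block x i
  rw [lambdaMap, Finset.sum_eq_single_of_mem l (Finset.mem_range.2 hl)
    fun k _ hk => if_neg fun h => hk (block_unique x h hi), if_pos hi, hx.blockSum_eq hpos hl,
    (mem_block_iff hx.1.2 hl i).1 hi]
  have h1 := blockSum_pos (x := x) ha hl
  have h2 := hpos ⟨breakSeq x l, breakSeq_lt_of_lt x hl⟩
  field_simp

theorem IsQPSolution.JMap_eq (ha : ∀ t, 0 < a t) (hpos : ∀ t, 0 < x t)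
    (hx : IsQPSolution a s x) :
    JMap (fun i => √(s i)) a (numBlocks x) (breakSeq x) = ∑ t, √(s t) * x t := by
  have h1 : ∀ l ∈ Finset.range (numBlocks x),
      blockSum (fun i => √(s i)) (breakSeq x) l ^ 2 / blockSum a (breakSeq x) l =
      ∑ t, if breakSeq x l ≤ (t : Fin m).val ∧ t.val < breakSeq x (l + 1)
        then √(s t) * x t else 0 := by
    intro l hl
    rw [Finset.mem_range] at hl
    have hb := blockSum_pos (x := x) ha hl
    have h2 : blockSum (fun i => √(s i)) (breakSeq x) l ^ 2 / blockSum a (breakSeq x) l =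
        blockSum (fun i => √(s i)) (breakSeq x) l *
          x ⟨breakSeq x l, breakSeq_lt_of_lt x hl⟩ := by
      rw [hx.blockSum_eq hpos hl]
      field_simp
    rw [h2, blockSum, Finset.sum_mul, Finset.sum_filter]
    refine Finset.sum_congr rfl fun t _ => ?_
    split_ifs with ht
    · rw [(mem_block_iff hx.1.2 hl t).1 ht]
    · rfl
  rw [JMap, Finset.sum_congr rfl h1, Finset.sum_comm]
  refine Finset.sum_congr rfl fun t _ => ?_
  obtain ⟨l, hl, hi⟩ := exists_block x t
  rw [Finset.sum_eq_single_of_mem l (Finset.mem_range.2 hl)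
    fun k _ hk => if_neg fun h => hk (block_unique x h hi), if_pos hi]

end BlockFormulas


/-! ### Summation by parts and Ky Fan's inequality -/

/-- Abel's inequality: a non-negative monotone weight against a sequence with non-negative tails. -/
theorem sum_mul_nonneg_of_tails : ∀ {m : ℕ} {x a : Fin m → ℝ}, Monotone x → (∀ t, 0 ≤ x t) →
    (∀ k : ℕ, 0 ≤ ∑ t with k ≤ (t : Fin m).val, a t) → 0 ≤ ∑ t, x t * a t
  | 0, _, _, _, _, _ => by simp
  | m + 1, x, a, hx, h0, h => by
    -- Subtracting the smallest weight `x 0` splits off `x 0` times the full sum; the remaining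
    -- weights are again monotone and non-negative, with one entry fewer.
    have ih := sum_mul_nonneg_of_tails (x := fun t : Fin m => x t.succ - x 0)
      (a := fun t => a t.succ) (fun i j hij => sub_le_sub_right (hx (Fin.succ_le_succ_iff.2 hij)) _)
      (fun t => sub_nonneg.2 (hx (Fin.zero_le _))) fun k => by
        have := h (k + 1)
        simpa [Finset.sum_filter, Fin.sum_univ_succ] using this
    have hall := h 0
    simp only [zero_le, Finset.filter_true] at hall
    have key : ∑ t, x t * a t =
        x 0 * ∑ t, a t + ∑ t : Fin m, (x t.succ - x 0) * a t.succ := by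
      rw [Fin.sum_univ_succ, Fin.sum_univ_succ (f := a), mul_add, Finset.mul_sum, add_assoc,
        ← Finset.sum_add_distrib]
      congr 1
      exact Finset.sum_congr rfl fun t _ => by ring
    rw [key]
    exact add_nonneg (mul_nonneg (h0 0) hall) ih

section Fan

variable {E : Type*} [NormedAddCommGroup E] [InnerProductSpace ℝ E]

theorem sum_sq_inner_le_norm_sq {ι : Type*} [Fintype ι] {w : ι → E} (hw : Orthonormal ℝ w)
    (a : E) : ∑ i, (inner ℝ (w i) a) ^ 2 ≤ ‖a‖ ^ 2 := by
  have := hw.sum_inner_products_le a (s := Finset.univ)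
  simpa using this

/-- Ky Fan's inequality: the trace of a symmetric operator over an orthonormal family is at least
the sum of the smallest eigenvalues. -/
theorem tail_le_sum_inner_sq {n k : ℕ} (v : OrthonormalBasis (Fin n) ℝ E) {lam : Fin n → ℝ}
    (hlam : Antitone lam) {ι : Type*} [Fintype ι] {w : ι → E} (hw : Orthonormal ℝ w)
    (hcard : Fintype.card ι + k = n) :
    ∑ t with k ≤ (t : Fin n).val, lam t ≤ ∑ i, ∑ t, lam t * (inner ℝ (w i) (v t)) ^ 2 := by
  rcases (Nat.le_of_add_left_le hcard.le).eq_or_lt with hk | hk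
  · have : IsEmpty ι := Fintype.card_eq_zero_iff.1 (by omega)
    rw [Finset.sum_eq_zero fun t ht => ?_]
    · simp
    · have := t.2
      simp only [Finset.mem_filter, Finset.mem_univ, true_and] at ht
      omega
  -- The weights `p t` lie in `[0, 1]` and have the same total as the indicator of the tail. Each
  -- product `(lam t - lam k) * (p t - 1_{k ≤ t})` is non-negative, and the `lam k` part cancels in
  -- the sum.
  set p : Fin n → ℝ := fun t => ∑ i, (inner ℝ (w i) (v t)) ^ 2 with hp
  have hp0 : ∀ t, 0 ≤ p t := fun t => Finset.sum_nonneg fun i _ => sq_nonneg _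
  have hp1 : ∀ t, p t ≤ 1 := fun t => by
    have := sum_sq_inner_le_norm_sq hw (v t)
    rwa [v.norm_eq_one, one_pow] at this
  have hpsum : ∑ t, p t = Fintype.card ι := by
    simp only [hp]
    rw [Finset.sum_comm]
    simp [v.sum_sq_inner_left, hw.norm_eq_one]
  have hcount : ∑ t : Fin n, (if k ≤ t.val then (1 : ℝ) else 0) = Fintype.card ι := by
    have h1 : (Finset.univ.filter fun t : Fin n => k ≤ t.val) = Finset.Ici ⟨k, hk⟩ := by
      ext t; simp [Fin.le_def]
    rw [Finset.sum_boole, h1, Fin.card_Ici, Nat.cast_inj]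
    dsimp only
    omega
  have hmain : 0 ≤ ∑ t, (lam t - lam ⟨k, hk⟩) * (p t - if k ≤ t.val then 1 else 0) := by
    refine Finset.sum_nonneg fun t _ => ?_
    split_ifs with h
    · exact mul_nonneg_of_nonpos_of_nonpos (sub_nonpos.2 (hlam h)) (sub_nonpos.2 (hp1 t))
    · have : lam ⟨k, hk⟩ ≤ lam t := hlam (by rw [Fin.le_def]; dsimp only; omega)
      rw [sub_zero]
      exact mul_nonneg (sub_nonneg.2 this) (hp0 t)
  have hexp : ∑ t, (lam t - lam ⟨k, hk⟩) * (p t - if k ≤ t.val then 1 else 0) =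
      ∑ t, lam t * p t - ∑ t with k ≤ (t : Fin n).val, lam t := by
    have : ∀ t : Fin n, (lam t - lam ⟨k, hk⟩) * (p t - if k ≤ t.val then 1 else 0) =
        lam t * p t - (if k ≤ t.val then lam t else 0) -
          lam ⟨k, hk⟩ * (p t - if k ≤ t.val then 1 else 0) := fun t => by split_ifs <;> ring
    simp only [this]
    rw [Finset.sum_sub_distrib, ← Finset.mul_sum, Finset.sum_sub_distrib, Finset.sum_sub_distrib,
      hpsum, hcount, Finset.sum_filter]
    ring
  have hswap : ∑ i, ∑ t, lam t * (inner ℝ (w i) (v t)) ^ 2 = ∑ t, lam t * p t := by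
    rw [Finset.sum_comm]
    simp only [hp, Finset.mul_sum]
  rw [hswap]
  linarith

/-- The tail sums of the eigenvalues of a frame operator are at most those of the squared norms of
the frame vectors. -/
theorem tail_le_of_frame {n K k : ℕ} (hk : k ≤ n) (v : OrthonormalBasis (Fin n) ℝ E)
    {lam : Fin n → ℝ} (hlam : Antitone lam) {d : Fin K → E}
    (hd : ∀ a, ∑ i, (inner ℝ (d i) a) ^ 2 = ∑ t, lam t * (inner ℝ (v t) a) ^ 2) :
    ∑ t with k ≤ (t : Fin n).val, lam t ≤ ∑ i with k ≤ (i : Fin K).val, inner ℝ (d i) (d i) := by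
  classical
  have : FiniteDimensional ℝ E := v.toBasis.finiteDimensional_of_finite
  have hn : Module.finrank ℝ E = n := by simpa using Module.finrank_eq_card_basis v.toBasis
  set s : Finset E := (Finset.univ.filter fun i : Fin K => i.val < k).image d
  set U : Submodule ℝ E := Submodule.span ℝ (s : Set E)
  have hs : s.card ≤ k := by
    refine Finset.card_image_le.trans ?_
    refine (Finset.card_le_card_of_injOn (t := Finset.range k) (fun i : Fin K => i.val)
      (fun i hi => ?_) (Fin.val_injective.injOn)).trans (Finset.card_range k).le
    simpa using hi
  have hU : Module.finrank ℝ U ≤ k := (finrank_span_finset_le_card s).trans hs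
  have hperp : n - k ≤ Module.finrank ℝ Uᗮ := by
    have := U.finrank_add_finrank_orthogonal
    omega
  set b := stdOrthonormalBasis ℝ Uᗮ
  -- Orthonormal vectors orthogonal to the first `k` frame vectors: over them those vectors
  -- contribute nothing, and each other vector contributes at most its squared norm, by Bessel.
  set w : Fin (n - k) → E := fun i => (b (Fin.castLE hperp i) : E)
  have hw : Orthonormal ℝ w :=
    (b.orthonormal.comp_linearIsometry Uᗮ.subtypeₗᵢ).comp _ (Fin.castLE_injective hperp)
  refine (tail_le_sum_inner_sq v hlam hw (k := k) (by simp [hk])).trans ?_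
  have h1 : ∑ i, ∑ t, lam t * (inner ℝ (w i) (v t)) ^ 2 = ∑ j, ∑ i, (inner ℝ (w i) (d j)) ^ 2 := by
    rw [Finset.sum_comm (s := Finset.univ (α := Fin K))]
    refine Finset.sum_congr rfl fun i _ => ?_
    simp_rw [real_inner_comm _ (w i)]
    exact (hd (w i)).symm
  rw [h1, Finset.sum_filter]
  refine Finset.sum_le_sum fun j _ => ?_
  split_ifs with hj
  · rw [real_inner_self_eq_norm_sq]
    exact sum_sq_inner_le_norm_sq hw (d j)
  · refine (Finset.sum_eq_zero fun i _ => ?_).le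
    have hmem : d j ∈ U := Submodule.subset_span (by
      simp only [s, Finset.coe_image, Finset.coe_filter, Finset.mem_univ, true_and]
      exact ⟨j, by simpa using hj, rfl⟩)
    have := Submodule.inner_left_of_mem_orthogonal hmem (b (Fin.castLE hperp i)).2
    simp only [w]
    rw [this]
    norm_num

end Fan

/-! ### Frames with prescribed norms and frame operator -/

section Frames

variable {E : Type*} [NormedAddCommGroup E] [InnerProductSpace ℝ E]

/-- Rotating the pair `(u, w)` by any angle preserves `u ⊗ u + w ⊗ w`. A quarter turn moves the
first squared norm continuously from that of `u` to that of `w`, so it takes every value between. -/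
theorem exists_rotation (u w : E) {b : ℝ} (hb : inner ℝ w w ≤ b) (hb' : b ≤ inner ℝ u u) :
    ∃ u' w' : E, inner ℝ u' u' = b ∧ inner ℝ w' w' = inner ℝ u u + inner ℝ w w - b ∧
      ∀ x y, inner ℝ u' x * inner ℝ u' y + inner ℝ w' x * inner ℝ w' y =
        inner ℝ u x * inner ℝ u y + inner ℝ w x * inner ℝ w y := by
  set g : ℝ → E := fun θ => Real.cos θ • u + Real.sin θ • w with hg
  have hcont : Continuous fun θ => (inner ℝ (g θ) (g θ) : ℝ) := by
    simp only [hg]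
    fun_prop
  have hivt := intermediate_value_Icc' (Real.pi_div_two_pos.le) hcont.continuousOn
  obtain ⟨θ, -, hθ⟩ := hivt (show b ∈ _ by
    simp only [hg, Real.cos_zero, Real.sin_zero, Real.cos_pi_div_two, Real.sin_pi_div_two,
      one_smul, zero_smul, add_zero, zero_add]
    exact ⟨hb, hb'⟩)
  refine ⟨g θ, -Real.sin θ • u + Real.cos θ • w, hθ, ?_, fun x y => ?_⟩
  · rw [← hθ]
    simp only [hg, inner_add_left, inner_add_right, inner_smul_left, inner_smul_right,
      real_inner_comm w u, conj_trivial]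
    linear_combination (inner ℝ u u + inner ℝ w w : ℝ) * Real.sin_sq_add_cos_sq θ
  · simp only [hg, inner_add_left, inner_smul_left, conj_trivial]
    linear_combination (inner ℝ u x * inner ℝ u y + inner ℝ w x * inner ℝ w y : ℝ) *
      Real.sin_sq_add_cos_sq θ

theorem sum_update_update {ι A : Type*} [Fintype ι] [DecidableEq ι] (F : ι → A → ℝ) (d : ι → A)
    {j k : ι} (hjk : j ≠ k) (u w : A) :
    ∑ i, F i (Function.update (Function.update d j u) k w i) =
      ∑ i, F i (d i) + (F j u - F j (d j)) + (F k w - F k (d k)) := by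
  rw [add_assoc, ← sub_eq_iff_eq_add', ← Finset.sum_sub_distrib,
    Finset.sum_eq_add j k hjk (fun c _ hc => by simp [hc.1, hc.2]) (by simp) (by simp)]
  simp [hjk]

/-- The constructive half of the Schur-Horn theorem for frames: a frame can be rotated, keeping its
frame operator, to any non-increasing sequence of squared norms that its own ones majorize. -/
theorem exists_frame_of_majorized {K : ℕ} {ℓ : Fin K → ℝ} (hℓ : Antitone ℓ) (d : Fin K → E)
    (htail : ∀ k : ℕ, ∑ i with k ≤ (i : Fin K).val, inner ℝ (d i) (d i) ≤
      ∑ i with k ≤ (i : Fin K).val, ℓ i)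
    (htot : ∑ i, inner ℝ (d i) (d i) = ∑ i, ℓ i) :
    ∃ d' : Fin K → E, (∀ i, inner ℝ (d' i) (d' i) = ℓ i) ∧
      ∀ x y, ∑ i, inner ℝ (d' i) x * inner ℝ (d' i) y =
        ∑ i, inner ℝ (d i) x * inner ℝ (d i) y := by
  induction hN : (Finset.univ.filter fun i => (inner ℝ (d i) (d i) : ℝ) ≠ ℓ i).card
    using Nat.strong_induction_on generalizing d with
  | _ N ih =>
  -- If no squared norm is too large, equality of the totals makes all of them right. Otherwise one
  -- rotation reduces the number of wrong indices.
  by_cases hall : ∀ i, inner ℝ (d i) (d i) ≤ ℓ i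
  · refine ⟨d, fun i => ?_, fun _ _ => rfl⟩
    exact (Finset.sum_eq_sum_iff_of_le fun i _ => hall i).1 htot i (Finset.mem_univ i)
  push Not at hall
  set G : Finset (Fin K) := Finset.univ.filter fun i => ℓ i < inner ℝ (d i) (d i) with hG
  have hGne : G.Nonempty := by
    obtain ⟨i, hi⟩ := hall
    exact ⟨i, by simpa [hG] using hi⟩
  -- With `j` the last index in excess, the tail inequality at `j` forces a deficit at some later
  -- `k`. Then `‖d k‖² < ℓ k ≤ ℓ j < ‖d j‖²`, which leaves room to transfer `δ`; the smaller
  -- discrepancy as `δ` settles one of the two indices.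
  set j := G.max' hGne
  have hj : ℓ j < inner ℝ (d j) (d j) := by
    have := G.max'_mem hGne
    simpa only [hG, Finset.mem_filter, Finset.mem_univ, true_and] using this
  have hafter : ∀ i, j < i → inner ℝ (d i) (d i) ≤ ℓ i := fun i hi => by
    by_contra hlt
    have := G.le_max' i (by simpa [hG] using hlt)
    exact absurd hi (not_lt.2 this)
  obtain ⟨k, hjk, hk⟩ : ∃ k, j < k ∧ inner ℝ (d k) (d k) < ℓ k := by
    by_contra! hno
    refine absurd (htail j.val) (not_le.2 (Finset.sum_lt_sum (fun i hi => ?_)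
      ⟨j, by simp, hj⟩))
    rcases (show j ≤ i by simpa using hi).eq_or_lt with h | h
    · rw [← h]; exact hj.le
    · exact hno i h
  have hℓjk : ℓ k ≤ ℓ j := hℓ hjk.le
  set δ : ℝ := min (inner ℝ (d j) (d j) - ℓ j) (ℓ k - inner ℝ (d k) (d k)) with hδ
  have hδ0 : 0 < δ := lt_min (by linarith) (by linarith)
  have hδ1 : δ ≤ inner ℝ (d j) (d j) - ℓ j := min_le_left _ _
  have hδ2 : δ ≤ ℓ k - inner ℝ (d k) (d k) := min_le_right _ _
  obtain ⟨u, w, hu, hw, huw⟩ := exists_rotation (d j) (d k)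
    (b := inner ℝ (d j) (d j) - δ) (by linarith) (by linarith)
  have hw' : inner ℝ w w = inner ℝ (d k) (d k) + δ := by rw [hw]; ring
  set d₁ := Function.update (Function.update d j u) k w with hd₁
  have hd₁j : d₁ j = u := by simp [hd₁, hjk.ne]
  have hd₁k : d₁ k = w := by simp [hd₁]
  have hd₁o : ∀ i, i ≠ j → i ≠ k → d₁ i = d i := fun i h1 h2 => by simp [hd₁, h1, h2]
  have hlt : (Finset.univ.filter fun i => (inner ℝ (d₁ i) (d₁ i) : ℝ) ≠ ℓ i).card < N := by
    rw [← hN]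
    refine Finset.card_lt_card ⟨fun i hi => ?_, fun hsub => ?_⟩
    · simp only [Finset.mem_filter, Finset.mem_univ, true_and] at hi ⊢
      by_cases h1 : i = j
      · rw [h1]; exact hj.ne'
      by_cases h2 : i = k
      · rw [h2]; exact hk.ne
      rwa [hd₁o i h1 h2] at hi
    · have h1 := hsub (show j ∈ _ by simpa using hj.ne')
      have h2 := hsub (show k ∈ _ by simpa using hk.ne)
      simp only [Finset.mem_filter, Finset.mem_univ, true_and, hd₁j, hd₁k, hu, hw'] at h1 h2
      rcases min_choice (inner ℝ (d j) (d j) - ℓ j) (ℓ k - inner ℝ (d k) (d k)) with h | h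
      · rw [← hδ] at h
        exact h1 (by rw [h]; ring)
      · rw [← hδ] at h
        exact h2 (by rw [h]; ring)
  have htail₁ : ∀ t : ℕ, ∑ i with t ≤ (i : Fin K).val, inner ℝ (d₁ i) (d₁ i) ≤
      ∑ i with t ≤ (i : Fin K).val, ℓ i := by
    intro t
    have h := sum_update_update (fun i z => if t ≤ (i : Fin K).val then inner ℝ z z else 0)
      d hjk.ne u w
    rw [← hd₁] at h
    simp only [← Finset.sum_filter] at h
    rw [h, hu, hw']
    by_cases h1 : t ≤ j.val
    · have h2 : t ≤ k.val := h1.trans hjk.le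
      simp only [h1, h2, if_true]
      linarith [htail t]
    -- Only tails that contain `k` but not `j` grow. Past `j` all slacks are non-negative, so the
    -- tail slack is at least that of `k`, hence at least `δ`.
    · by_cases h2 : t ≤ k.val
      · simp only [h1, h2, if_true, if_false]
        have h3 : ℓ k - inner ℝ (d k) (d k) ≤
            ∑ i with t ≤ (i : Fin K).val, (ℓ i - inner ℝ (d i) (d i)) :=
          Finset.single_le_sum (f := fun i => ℓ i - inner ℝ (d i) (d i))
            (fun i hi => sub_nonneg.2 (hafter i (by
              simp only [Finset.mem_filter, Finset.mem_univ, true_and] at hi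
              rw [Fin.lt_def]; omega))) (by simpa using h2)
        rw [Finset.sum_sub_distrib] at h3
        linarith
      · simp only [h1, h2, if_false]
        linarith [htail t]
  have htot₁ : ∑ i, inner ℝ (d₁ i) (d₁ i) = ∑ i, ℓ i := by
    have h := sum_update_update (fun _ z => inner ℝ z z) d hjk.ne u w
    rw [← hd₁] at h
    rw [h, hu, hw', ← htot]
    ring
  obtain ⟨d', hd', hB⟩ := ih _ hlt d₁ htail₁ htot₁ rfl
  refine ⟨d', hd', fun x y => (hB x y).trans ?_⟩
  rw [hd₁, sum_update_update (fun _ z => inner ℝ z x * inner ℝ z y) d hjk.ne]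
  linarith [huw x y]

end Frames

/-! ### Folded lengths -/

section Folded

variable {n K : ℕ}

theorem foldedLengths_pos (hnK : n ≤ K) {ℓ : Fin K → ℝ} (hℓ : ∀ i, 0 < ℓ i) (t : Fin n) :
    0 < foldedLengths hnK ℓ t := by
  unfold foldedLengths
  split_ifs
  · exact hℓ _
  · exact Finset.sum_pos (fun i _ => hℓ i) ⟨Fin.castLE hnK t, by simp⟩

theorem tail_foldedLengths (hnK : n ≤ K) (ℓ : Fin K → ℝ) {k : ℕ} (hk : k < n) :
    ∑ t with k ≤ (t : Fin n).val, foldedLengths hnK ℓ t = ∑ i with k ≤ (i : Fin K).val, ℓ i := by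
  -- Folding sends all indices from `n - 1` on to `n - 1`; `ℓ'` is the sum of `ℓ` over the fibres.
  -- The second summand in `h1` only makes the identity trivial below `k`.
  set g : Fin K → Fin n := fun i => ⟨min i.val (n - 1), by omega⟩ with hg
  have h1 : ∀ t : Fin n, foldedLengths hnK ℓ t =
      ∑ i with (k ≤ (i : Fin K).val ∧ g i = t), ℓ i + if k ≤ t.val then 0 else
        foldedLengths hnK ℓ t := by
    intro t
    split_ifs with hkt
    · rw [add_zero, foldedLengths]
      split_ifs with ht
      · rw [Finset.sum_eq_single_of_mem (Fin.castLE hnK t)]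
        · simp only [hg, Fin.ext_iff, Finset.mem_filter, Finset.mem_univ, true_and,
            Fin.val_castLE]
          omega
        · intro i hi hit
          simp only [hg, Fin.ext_iff, Finset.mem_filter, Finset.mem_univ, true_and,
            Fin.val_castLE, ne_eq] at hi hit
          omega
      · refine Finset.sum_congr (Finset.filter_congr fun i _ => ?_) fun _ _ => rfl
        simp only [hg, Fin.ext_iff]
        omega
    · rw [Finset.sum_eq_zero, zero_add]
      intro i hi
      simp only [hg, Fin.ext_iff, Finset.mem_filter, Finset.mem_univ, true_and] at hi
      omega
  rw [← Finset.sum_fiberwise_of_maps_to (g := g)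
    (t := Finset.univ.filter fun t : Fin n => k ≤ t.val) (fun i hi => ?_)]
  · refine Finset.sum_congr rfl fun t ht => ?_
    rw [h1 t, if_pos (by simpa using ht), add_zero, Finset.filter_filter]
  · simp only [hg, Finset.mem_filter, Finset.mem_univ, true_and] at hi ⊢
    omega

theorem sum_foldedLengths (hn : 0 < n) (hnK : n ≤ K) (ℓ : Fin K → ℝ) :
    ∑ t, foldedLengths hnK ℓ t = ∑ i, ℓ i := by
  simpa using tail_foldedLengths hnK ℓ hn

end Folded


/-! ### The lower bound and its equality case -/

section Core

variable {n : ℕ}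

theorem tail_eq_add {f : Fin n → ℝ} {k : ℕ} (hk : k < n) :
    ∑ t with k ≤ (t : Fin n).val, f t = f ⟨k, hk⟩ + ∑ t with k + 1 ≤ (t : Fin n).val, f t := by
  have : (Finset.univ.filter fun t : Fin n => k ≤ t.val) =
      insert ⟨k, hk⟩ (Finset.univ.filter fun t : Fin n => k + 1 ≤ t.val) := by
    ext t
    simp only [Finset.mem_filter, Finset.mem_univ, true_and, Finset.mem_insert, Fin.ext_iff]
    omega
  rw [this, Finset.sum_insert (by simp)]

theorem tail_eq_zero (f : Fin n → ℝ) {k : ℕ} (hk : n ≤ k) :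
    ∑ t with k ≤ (t : Fin n).val, f t = 0 :=
  Finset.sum_eq_zero fun t ht => by
    have := t.2
    simp only [Finset.mem_filter, Finset.mem_univ, true_and] at ht
    omega

theorem card_tail {k : ℕ} (hk : k ≤ n) :
    (Finset.univ.filter fun t : Fin n => k ≤ t.val).card + k = n := by
  rcases hk.eq_or_lt with rfl | hk
  · rw [Finset.card_eq_zero.2, zero_add]
    ext t
    simp
  · have h1 : (Finset.univ.filter fun t : Fin n => k ≤ t.val) = Finset.Ici ⟨k, hk⟩ := by
      ext t; simp [Fin.le_def]
    rw [h1, Fin.card_Ici]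
    dsimp only
    omega

theorem antitone_of_consecutive {f : Fin n → ℝ}
    (h : ∀ k (hk : k + 1 < n), f ⟨k + 1, hk⟩ ≤ f ⟨k, by omega⟩) : Antitone f := by
  intro i j hij
  obtain ⟨j, hj⟩ := j
  rw [Fin.le_def] at hij
  dsimp only at hij
  induction j, hij using Nat.le_induction with
  | base => exact le_rfl
  | succ j hle ih => exact (h j hj).trans (ih (by omega))

variable {E : Type*} [NormedAddCommGroup E] [InnerProductSpace ℝ E]

theorem tail_le_sum_finset (u : OrthonormalBasis (Fin n) ℝ E) {c : Fin n → ℝ} (hc : Antitone c)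
    {v : Fin n → E} (hv : Orthonormal ℝ v) {k : ℕ} {A : Finset (Fin n)} (hA : A.card + k = n) :
    ∑ s with k ≤ (s : Fin n).val, c s ≤ ∑ t ∈ A, ∑ s, c s * (inner ℝ (u s) (v t)) ^ 2 := by
  have h := tail_le_sum_inner_sq u hc (hv.comp ((↑) : A → Fin n) Subtype.val_injective)
    (k := k) (by simpa using hA)
  refine h.trans_eq ?_
  rw [← Finset.sum_coe_sort A]
  simp only [Function.comp_apply, real_inner_comm]

theorem tail_le_tail (u v : OrthonormalBasis (Fin n) ℝ E) {c : Fin n → ℝ} (hc : Antitone c)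
    (k : ℕ) :
    ∑ s with k ≤ (s : Fin n).val, c s ≤
      ∑ t with k ≤ (t : Fin n).val, ∑ s, c s * (inner ℝ (u s) (v t)) ^ 2 := by
  rcases le_total k n with hk | hk
  · exact tail_le_sum_finset u hc v.orthonormal (card_tail hk)
  · rw [tail_eq_zero _ hk, tail_eq_zero _ hk]

variable {a s x lam : Fin n → ℝ} {u v : OrthonormalBasis (Fin n) ℝ E}

/-- Expand `s i / lam t = (√(s i) - x t * lam t)² / lam t + 2 * x t * √(s i) - x t² * lam t` and sum
with the weights `⟨u i, v t⟩²`, whose sum over `i` is one; then use `∑ a x² = ∑ √s x`. -/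
theorem trace_decomposition (hs : ∀ t, 0 ≤ s t) (hlam : ∀ t, 0 < lam t)
    (hpos : ∀ t, 0 < x t) (hx : IsQPSolution a s x) :
    ∑ t, (lam t)⁻¹ * ∑ i, s i * (inner ℝ (u i) (v t)) ^ 2 =
      ∑ t, √(s t) * x t +
      ∑ t, ∑ i, (inner ℝ (u i) (v t)) ^ 2 * (√(s i) - x t * lam t) ^ 2 * (lam t)⁻¹ +
      2 * ∑ t, x t * (∑ i, √(s i) * (inner ℝ (u i) (v t)) ^ 2 - √(s t)) +
      ∑ t, x t ^ 2 * (a t - lam t) := by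
  have h1 := hx.sum_sq_eq hpos
  have h2 : ∀ t, ∑ i, (inner ℝ (u i) (v t)) ^ 2 * (√(s i) - x t * lam t) ^ 2 * (lam t)⁻¹ =
      (lam t)⁻¹ * ∑ i, s i * (inner ℝ (u i) (v t)) ^ 2 -
      2 * x t * ∑ i, √(s i) * (inner ℝ (u i) (v t)) ^ 2 + x t ^ 2 * lam t := by
    intro t
    have h3 : x t ^ 2 * lam t = ∑ i, x t ^ 2 * lam t * (inner ℝ (u i) (v t)) ^ 2 := by
      rw [← Finset.mul_sum, u.sum_sq_inner_right, v.norm_eq_one]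
      simp
    rw [h3, Finset.mul_sum, Finset.mul_sum, ← Finset.sum_sub_distrib, ← Finset.sum_add_distrib]
    refine Finset.sum_congr rfl fun i _ => ?_
    have h4 := Real.sq_sqrt (hs i)
    have h5 := (hlam t).ne'
    field_simp
    rw [sub_sq, h4]
    ring
  have h6 : ∑ t, x t ^ 2 * (a t - lam t) = ∑ t, a t * x t ^ 2 - ∑ t, x t ^ 2 * lam t := by
    rw [← Finset.sum_sub_distrib]
    exact Finset.sum_congr rfl fun t _ => by ring
  have h7 : ∑ t, x t * (∑ i, √(s i) * (inner ℝ (u i) (v t)) ^ 2 - √(s t)) =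
      ∑ t, x t * ∑ i, √(s i) * (inner ℝ (u i) (v t)) ^ 2 - ∑ t, √(s t) * x t := by
    rw [← Finset.sum_sub_distrib]
    exact Finset.sum_congr rfl fun t _ => by ring
  simp only [h2]
  rw [h6, h7, h1, Finset.sum_add_distrib, Finset.sum_sub_distrib]
  simp only [mul_assoc, ← Finset.mul_sum]
  ring

theorem sqrt_antitone (hsa : Antitone s) : Antitone fun t => √(s t) :=
  fun _ _ h => Real.sqrt_le_sqrt (hsa h)

/-- Abel summation with Ky Fan's tail bounds. The weight is any feasible `y`, since the equality
case also needs a perturbation of `x`. -/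
theorem sum_mul_diag_nonneg (hsa : Antitone s) {y : Fin n → ℝ} (hy : QPFeasible y) :
    0 ≤ ∑ t, y t * (∑ i, √(s i) * (inner ℝ (u i) (v t)) ^ 2 - √(s t)) :=
  sum_mul_nonneg_of_tails hy.2 hy.1 fun k => by
    rw [Finset.sum_sub_distrib]
    exact sub_nonneg.2 (tail_le_tail u v (sqrt_antitone hsa) k)

theorem sum_sq_mul_sub_nonneg (hx : QPFeasible x)
    (htail : ∀ k : ℕ, ∑ t with k ≤ (t : Fin n).val, lam t ≤ ∑ t with k ≤ (t : Fin n).val, a t) :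
    0 ≤ ∑ t, x t ^ 2 * (a t - lam t) :=
  sum_mul_nonneg_of_tails (x := fun t => x t ^ 2)
    (fun i _ hij => pow_le_pow_left₀ (hx.1 i) (hx.2 hij) 2)
    (fun _ => sq_nonneg _) fun k => by
      rw [Finset.sum_sub_distrib]
      exact sub_nonneg.2 (htail k)

theorem le_trace (hs : ∀ t, 0 ≤ s t) (hsa : Antitone s) (hlam : ∀ t, 0 < lam t)
    (hpos : ∀ t, 0 < x t) (hx : IsQPSolution a s x)
    (htail : ∀ k : ℕ, ∑ t with k ≤ (t : Fin n).val, lam t ≤ ∑ t with k ≤ (t : Fin n).val, a t) :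
    ∑ t, √(s t) * x t ≤ ∑ t, (lam t)⁻¹ * ∑ i, s i * (inner ℝ (u i) (v t)) ^ 2 := by
  rw [trace_decomposition hs hlam hpos hx]
  have h1 := sum_mul_diag_nonneg (u := u) (v := v) hsa hx.1
  have h2 := sum_sq_mul_sub_nonneg hx.1 htail
  have h3 : 0 ≤ ∑ t, ∑ i, (inner ℝ (u i) (v t)) ^ 2 * (√(s i) - x t * lam t) ^ 2 * (lam t)⁻¹ :=
    Finset.sum_nonneg fun t _ => Finset.sum_nonneg fun i _ => by
      have := hlam t
      positivity
  linarith

/-- Equality in `le_trace` forces the eigenvalues `lam` and makes `v` a basis of eigenvectors. -/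
theorem eq_of_trace_le (hs : ∀ t, 0 ≤ s t) (hsa : Antitone s) (hlam : ∀ t, 0 < lam t)
    (hlama : Antitone lam) (hpos : ∀ t, 0 < x t) (hx : IsQPSolution a s x)
    (htail : ∀ k : ℕ, ∑ t with k ≤ (t : Fin n).val, lam t ≤ ∑ t with k ≤ (t : Fin n).val, a t)
    (hle : ∑ t, (lam t)⁻¹ * ∑ i, s i * (inner ℝ (u i) (v t)) ^ 2 ≤ ∑ t, √(s t) * x t) :
    (∀ t, lam t = √(s t) / x t) ∧ ∀ i t, inner ℝ (u i) (v t) = 0 ∨ s i = s t := by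
  set m : Fin n → ℝ := fun t => ∑ i, √(s i) * (inner ℝ (u i) (v t)) ^ 2 with hm
  have hdec := trace_decomposition (u := u) (v := v) hs hlam hpos hx
  have h1 := sum_mul_diag_nonneg (u := u) (v := v) hsa hx.1
  have h2 := sum_sq_mul_sub_nonneg hx.1 htail
  have hnn : ∀ t i, 0 ≤ (inner ℝ (u i) (v t)) ^ 2 * (√(s i) - x t * lam t) ^ 2 * (lam t)⁻¹ :=
    fun t i => by
      have := hlam t
      positivity
  have h3 := Finset.sum_nonneg fun t (_ : t ∈ Finset.univ) =>
    Finset.sum_nonneg fun i (_ : i ∈ Finset.univ) => hnn t i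
  have hD : ∑ t, ∑ i, (inner ℝ (u i) (v t)) ^ 2 * (√(s i) - x t * lam t) ^ 2 * (lam t)⁻¹ = 0 := by
    linarith
  have hF : ∑ t, x t * (m t - √(s t)) = 0 := by
    simp only [hm]
    linarith
  -- The squares vanish: `v t` involves only those `u i` with `√(s i) = x t * lam t`. Thus `m t = x
  -- t * lam t` is the eigenvalue at `v t` of the operator with eigenbasis `u` and eigenvalues `√s`;
  -- what remains is that `m` is in decreasing order.
  have hg : ∀ i t, inner ℝ (u i) (v t) = 0 ∨ √(s i) = x t * lam t := fun i t => by
    have h4 := (Finset.sum_eq_zero_iff_of_nonneg fun t _ =>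
      Finset.sum_nonneg fun i _ => hnn t i).1 hD t (Finset.mem_univ t)
    have h5 := (Finset.sum_eq_zero_iff_of_nonneg fun i _ => hnn t i).1 h4 i (Finset.mem_univ i)
    rcases mul_eq_zero.1 ((mul_eq_zero.1 h5).resolve_right (inv_ne_zero (hlam t).ne')) with h | h
    · exact Or.inl (pow_eq_zero_iff two_ne_zero |>.1 h)
    · exact Or.inr (sub_eq_zero.1 (pow_eq_zero_iff two_ne_zero |>.1 h))
  have hmx : ∀ t, m t = x t * lam t := fun t => by
    have h4 : x t * lam t = ∑ i, x t * lam t * (inner ℝ (u i) (v t)) ^ 2 := by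
      rw [← Finset.mul_sum, u.sum_sq_inner_right, v.norm_eq_one]
      simp
    rw [h4]
    refine Finset.sum_congr rfl fun i _ => ?_
    rcases hg i t with h | h
    · simp [h]
    · rw [h]
  have hca := sqrt_antitone hsa
  have hma : Antitone m := by
    refine antitone_of_consecutive fun k hk => ?_
    have hk' : k < n := by omega
    -- Where `x` is constant, the order of `m` comes from that of `lam`; a strict jump of `x` needs
    -- the argument below.
    rcases (hx.1.2 (show (⟨k, hk'⟩ : Fin n) ≤ ⟨k + 1, hk⟩ by simp)).eq_or_lt with h | h
    · rw [hmx, hmx, h]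
      exact mul_le_mul_of_nonneg_left (hlama (by simp)) (hpos _).le
    · have hle : ∑ t with k + 1 ≤ (t : Fin n).val, m t ≤
          ∑ t with k + 1 ≤ (t : Fin n).val, √(s t) := by
        -- Lowering `x` by the jump `δ` on the tail keeps it feasible. As the pairing with `x`
        -- itself vanishes, non-negativity for the lowered weight bounds the tail of `m` from above.
        set δ := x ⟨k + 1, hk⟩ - x ⟨k, hk'⟩ with hδ
        have hδ0 : 0 < δ := sub_pos.2 h
        have hle1 : ∀ t : Fin n, k + 1 ≤ t.val → x ⟨k + 1, hk⟩ ≤ x t := fun t ht => hx.1.2 ht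
        have hle2 : ∀ t : Fin n, ¬ k + 1 ≤ t.val → x t ≤ x ⟨k, hk'⟩ := fun t ht =>
          hx.1.2 (by rw [Fin.le_def]; dsimp only; omega)
        have hfe : QPFeasible fun t => x t - if k + 1 ≤ t.val then δ else 0 := by
          refine ⟨fun t => ?_, fun i j hij => ?_⟩
          · dsimp only
            split_ifs with ht
            · linarith [hle1 t ht, hx.1.1 ⟨k, hk'⟩]
            · linarith [hx.1.1 t]
          · have hxij := hx.1.2 hij
            rw [Fin.le_def] at hij
            dsimp only
            split_ifs with hi hj hj
            · linarith
            · omega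
            · linarith [hle1 j hj, hle2 i hi]
            · linarith
        have h5 := sum_mul_diag_nonneg (u := u) (v := v) hsa hfe
        have h6 : ∑ t, (x t - if k + 1 ≤ t.val then δ else 0) * (m t - √(s t)) =
            ∑ t, x t * (m t - √(s t)) -
              δ * ∑ t with k + 1 ≤ (t : Fin n).val, (m t - √(s t)) := by
          rw [Finset.mul_sum, Finset.sum_filter, ← Finset.sum_sub_distrib]
          refine Finset.sum_congr rfl fun t _ => ?_
          split_ifs <;> ring
        rw [show (∑ t, (x t - if k + 1 ≤ t.val then δ else 0) *
          (∑ i, √(s i) * (inner ℝ (u i) (v t)) ^ 2 - √(s t))) = _ from h6, hF, zero_sub,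
          Finset.sum_sub_distrib] at h5
        by_contra hlt
        rw [not_le] at hlt
        have := mul_pos hδ0 (sub_pos.2 hlt)
        linarith
      -- Ky Fan for the tail from `k + 1` with `k` in place of `k + 1`; comparison with `hle` gives
      -- `m (k + 1) ≤ m k`.
      set A : Finset (Fin n) :=
        insert ⟨k, hk'⟩ (Finset.univ.filter fun t : Fin n => k + 2 ≤ t.val) with hA
      have hnot : (⟨k, hk'⟩ : Fin n) ∉ Finset.univ.filter fun t : Fin n => k + 2 ≤ t.val := by
        simp
      have hcard : A.card + (k + 1) = n := by
        rw [hA, Finset.card_insert_of_notMem hnot]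
        have := card_tail (n := n) (k := k + 2) hk
        omega
      have h7 := tail_le_sum_finset u hca v.orthonormal hcard
      rw [hA, Finset.sum_insert hnot] at h7
      rw [tail_eq_add hk] at hle
      change _ ≤ m _ + ∑ t with k + 2 ≤ (t : Fin n).val, m t at h7
      linarith
  have htails : ∀ k : ℕ, ∑ t with k ≤ (t : Fin n).val, m t =
      ∑ t with k ≤ (t : Fin n).val, √(s t) := by
    -- Since `m` is decreasing, Ky Fan also applies with the two bases exchanged.
    refine fun k => le_antisymm ((tail_le_tail v u hma k).trans_eq ?_) (tail_le_tail u v hca k)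
    refine Finset.sum_congr rfl fun i _ => ?_
    have h8 : √(s i) = ∑ t, √(s i) * (inner ℝ (v t) (u i)) ^ 2 := by
      rw [← Finset.mul_sum, v.sum_sq_inner_right, u.norm_eq_one]
      simp
    rw [h8]
    refine Finset.sum_congr rfl fun t _ => ?_
    rw [real_inner_comm]
    rcases hg i t with h | h
    · simp [h]
    · rw [hmx, h]
  have hmc : ∀ t, m t = √(s t) := fun t => by
    have h9 := htails t.val
    rw [tail_eq_add t.2, tail_eq_add t.2, htails] at h9
    simpa using h9
  refine ⟨fun t => ?_, fun i t => (hg i t).imp_right fun h => ?_⟩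
  · rw [eq_div_iff (hpos t).ne', ← hmc, hmx, mul_comm]
  · rw [← hmx, hmc] at h
    exact (Real.sqrt_inj (hs i) (hs t)).1 h

end Core


/-! ### Frame operators as matrices and pseudo-inverses -/

section Matrices

variable {n K : ℕ}

theorem inner_eq_dotProduct (x y : EuclideanSpace ℝ (Fin n)) :
    inner ℝ x y = x.ofLp ⬝ᵥ y.ofLp := by
  rw [EuclideanSpace.inner_eq_star_dotProduct, dotProduct_comm]
  simp

theorem exists_eigenbasis {A : Matrix (Fin n) (Fin n) ℝ} (hA : A.IsHermitian) :
    ∃ v : OrthonormalBasis (Fin n) ℝ (EuclideanSpace ℝ (Fin n)), ∀ i,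
      A.mulVec (v i).ofLp =
        hA.eigenvalues₀ (Fin.cast (Fintype.card_fin n).symm i) • (v i).ofLp := by
  -- This relabelling undoes the arbitrary equivalence in `eigenvalues`, so that `v i` belongs to
  -- the `i`-th sorted eigenvalue.
  set e : Fin n ≃ Fin n := (finCongr (Fintype.card_fin n).symm).trans
    (Fintype.equivOfCardEq (Fintype.card_fin _))
  refine ⟨hA.eigenvectorBasis.reindex e.symm, fun i => ?_⟩
  rw [OrthonormalBasis.reindex_apply, Equiv.symm_symm, hA.mulVec_eigenvectorBasis]
  simp [Matrix.IsHermitian.eigenvalues, e]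

theorem outer_mulVec (d a : EuclideanSpace ℝ (Fin n)) :
    (outer d).mulVec a.ofLp = (inner ℝ d a : ℝ) • d.ofLp := by
  rw [inner_eq_dotProduct, outer, Matrix.vecMulVec_mulVec]
  simp

theorem dotProduct_sum_outer {ι : Type*} [Fintype ι] (r : ι → ℝ)
    (d : ι → EuclideanSpace ℝ (Fin n)) (x y : EuclideanSpace ℝ (Fin n)) :
    x.ofLp ⬝ᵥ (∑ i, r i • outer (d i)).mulVec y.ofLp =
      ∑ i, r i * (inner ℝ (d i) x * inner ℝ (d i) y) := by
  rw [Matrix.sum_mulVec, dotProduct_sum]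
  refine Finset.sum_congr rfl fun i _ => ?_
  rw [Matrix.smul_mulVec, outer_mulVec, dotProduct_smul, dotProduct_smul, ← inner_eq_dotProduct,
    real_inner_comm x, smul_eq_mul, smul_eq_mul]
  ring

theorem sum_outer_eq_iff {v : Fin n → EuclideanSpace ℝ (Fin n)}
    {lam : Fin n → ℝ} {d : Fin K → EuclideanSpace ℝ (Fin n)} :
    ∑ i, outer (d i) = ∑ t, lam t • outer (v t) ↔
      ∀ x y, ∑ i, inner ℝ (d i) x * inner ℝ (d i) y =
        ∑ t, lam t * (inner ℝ (v t) x * inner ℝ (v t) y) := by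
  have h1 : ∑ i, outer (d i) = ∑ i, (1 : ℝ) • outer (d i) := by simp
  constructor
  · intro h x y
    rw [← dotProduct_sum_outer, ← h, h1, dotProduct_sum_outer]
    simp
  · intro h
    ext i j
    have := h (EuclideanSpace.single i 1) (EuclideanSpace.single j 1)
    simpa [Matrix.sum_apply, outer, Matrix.vecMulVec_apply, EuclideanSpace.inner_single_right]
      using this

theorem sum_outer_orthonormalBasis (v : OrthonormalBasis (Fin n) ℝ (EuclideanSpace ℝ (Fin n))) :
    ∑ t, outer (v t) = 1 := by
  ext i j
  have h := v.sum_inner_mul_inner (EuclideanSpace.single i 1) (EuclideanSpace.single j 1)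
  simp only [EuclideanSpace.inner_single_left, EuclideanSpace.inner_single_right,
    map_one, one_mul, conj_trivial] at h
  rw [Matrix.sum_apply, Matrix.one_apply]
  simp only [outer, Matrix.vecMulVec_apply]
  rw [h]
  simp [eq_comm]

theorem eq_sum_outer {A : Matrix (Fin n) (Fin n) ℝ}
    (v : OrthonormalBasis (Fin n) ℝ (EuclideanSpace ℝ (Fin n))) {lam : Fin n → ℝ}
    (h : ∀ t, A.mulVec (v t).ofLp = lam t • (v t).ofLp) : A = ∑ t, lam t • outer (v t) := by
  calc A = A * ∑ t, outer (v t) := by rw [sum_outer_orthonormalBasis, Matrix.mul_one]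
    _ = ∑ t, lam t • outer (v t) := by
      rw [Matrix.mul_sum]
      refine Finset.sum_congr rfl fun t _ => ?_
      rw [outer, Matrix.mul_vecMulVec, h, Matrix.smul_vecMulVec]

theorem span_eq_top_iff {d : Fin K → EuclideanSpace ℝ (Fin n)} :
    Submodule.span ℝ (Set.range d) = ⊤ ↔ ∀ a, (∀ i, inner ℝ (d i) a = 0) → a = 0 := by
  rw [← Submodule.orthogonal_eq_bot_iff, Submodule.eq_bot_iff]
  refine forall_congr' fun a => imp_congr_left ?_
  rw [Submodule.mem_orthogonal]
  refine ⟨fun h i => h _ (Submodule.subset_span ⟨i, rfl⟩), fun h u hu => ?_⟩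
  induction hu using Submodule.span_induction with
  | mem y hy => obtain ⟨i, rfl⟩ := hy; exact h i
  | zero => simp
  | add y z _ _ hy hz => rw [inner_add_left, hy, hz, add_zero]
  | smul r y _ hy => rw [inner_smul_left, hy, mul_zero]

theorem isHermitian_sum_outer (d : Fin K → EuclideanSpace ℝ (Fin n)) :
    (∑ i, outer (d i)).IsHermitian := by
  ext i j
  simp [Matrix.sum_apply, outer, Matrix.vecMulVec_apply, mul_comm]

theorem sum_sq_of_sum_outer_eq {v : Fin n → EuclideanSpace ℝ (Fin n)}
    {lam : Fin n → ℝ} {d : Fin K → EuclideanSpace ℝ (Fin n)}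
    (h : ∑ i, outer (d i) = ∑ t, lam t • outer (v t)) (a : EuclideanSpace ℝ (Fin n)) :
    ∑ i, (inner ℝ (d i) a) ^ 2 = ∑ t, lam t * (inner ℝ (v t) a) ^ 2 := by
  have := sum_outer_eq_iff.1 h a a
  simpa only [sq] using this

theorem exists_sum_outer_eq {d : Fin K → EuclideanSpace ℝ (Fin n)}
    (hd : Submodule.span ℝ (Set.range d) = ⊤) :
    ∃ (v : OrthonormalBasis (Fin n) ℝ (EuclideanSpace ℝ (Fin n))) (lam : Fin n → ℝ),
      Antitone lam ∧ (∀ t, 0 < lam t) ∧ ∑ i, outer (d i) = ∑ t, lam t • outer (v t) := by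
  have hS := isHermitian_sum_outer d
  obtain ⟨v, hv⟩ := exists_eigenbasis hS
  have heq := eq_sum_outer v hv
  refine ⟨v, _, fun i j hij => hS.eigenvalues₀_antitone (by simpa using hij), fun t => ?_, heq⟩
  have h1 := sum_sq_of_sum_outer_eq heq (v t)
  rw [Finset.sum_eq_single_of_mem t (Finset.mem_univ t) fun i _ hi => by
    rw [v.orthonormal.2 hi]; simp, real_inner_self_eq_norm_sq, v.norm_eq_one, one_pow, one_pow,
    mul_one] at h1
  rw [← h1]
  refine lt_of_le_of_ne (Finset.sum_nonneg fun i _ => sq_nonneg _) fun h0 => ?_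
  have h2 := (Finset.sum_eq_zero_iff_of_nonneg fun i _ => sq_nonneg _).1 h0.symm
  have h3 := span_eq_top_iff.1 hd (v t) fun i => pow_eq_zero_iff two_ne_zero |>.1
    (h2 i (Finset.mem_univ i))
  have h4 := v.norm_eq_one t
  rw [h3, norm_zero] at h4
  exact zero_ne_one h4

theorem span_eq_top_of_sum_outer_eq {d : Fin K → EuclideanSpace ℝ (Fin n)}
    (v : OrthonormalBasis (Fin n) ℝ (EuclideanSpace ℝ (Fin n))) {lam : Fin n → ℝ}
    (hlam : ∀ t, 0 < lam t) (h : ∑ i, outer (d i) = ∑ t, lam t • outer (v t)) :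
    Submodule.span ℝ (Set.range d) = ⊤ := by
  refine span_eq_top_iff.2 fun a ha => ?_
  have h1 := sum_sq_of_sum_outer_eq h a
  simp only [ha, ne_eq, OfNat.ofNat_ne_zero, not_false_eq_true, zero_pow,
    Finset.sum_const_zero] at h1
  have h2 := (Finset.sum_eq_zero_iff_of_nonneg fun t _ =>
    mul_nonneg (hlam t).le (sq_nonneg _)).1 h1.symm
  have h3 : ‖a‖ ^ 2 = 0 := by
    rw [← v.sum_sq_inner_right]
    exact Finset.sum_eq_zero fun t ht =>
      (mul_eq_zero.1 (h2 t ht)).resolve_left (hlam t).ne'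
  exact norm_eq_zero.1 (pow_eq_zero_iff two_ne_zero |>.1 h3)

theorem dictMatrix_mul_transpose (d : Fin K → EuclideanSpace ℝ (Fin n)) :
    dictMatrix d * (dictMatrix d).transpose = ∑ i, outer (d i) := by
  ext i j
  simp [Matrix.mul_apply, Matrix.sum_apply, dictMatrix, outer, Matrix.vecMulVec_apply]

theorem dictMatrix_mulVec (d : Fin K → EuclideanSpace ℝ (Fin n)) (y : EuclideanSpace ℝ (Fin K)) :
    (dictMatrix d).mulVec y.ofLp = (∑ i, y i • d i).ofLp := by
  ext j
  simp [Matrix.mulVec, dotProduct, dictMatrix, mul_comm]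

/-- Take `P = DᵀS⁻¹` with `S = DDᵀ`. A representation `y` of `a` differs from `P a` by an element of
the kernel of `D`, which is orthogonal to the range of `Dᵀ`; Pythagoras gives the last clause. -/
theorem exists_pseudoInverse {d : Fin K → EuclideanSpace ℝ (Fin n)}
    (v : OrthonormalBasis (Fin n) ℝ (EuclideanSpace ℝ (Fin n))) {lam : Fin n → ℝ}
    (hlam : ∀ t, 0 < lam t) (h : ∑ i, outer (d i) = ∑ t, lam t • outer (v t)) :
    ∃ P : Matrix (Fin K) (Fin n) ℝ, IsPseudoInverse (dictMatrix d) P ∧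
      (∀ a, ∑ i, matScheme P a i • d i = a) ∧
      (∀ a, inner ℝ (matScheme P a) (matScheme P a) =
        ∑ t, (lam t)⁻¹ * (inner ℝ (v t) a) ^ 2) ∧
      ∀ (a : EuclideanSpace ℝ (Fin n)) (y : EuclideanSpace ℝ (Fin K)), ∑ i, y i • d i = a →
        inner ℝ y y = (inner ℝ (matScheme P a) (matScheme P a) : ℝ) +
          inner ℝ (y - matScheme P a) (y - matScheme P a) := by
  set D := dictMatrix d with hD
  set M : Matrix (Fin n) (Fin n) ℝ := ∑ t, (lam t)⁻¹ • outer (v t) with hM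
  have hMT : M.transpose = M := by
    ext i j
    simp [hM, Matrix.sum_apply, outer, Matrix.vecMulVec_apply, mul_comm]
  have hMv : ∀ t, M.mulVec (v t).ofLp = (lam t)⁻¹ • (v t).ofLp := fun t => by
    rw [hM, Matrix.sum_mulVec, Finset.sum_eq_single_of_mem t (Finset.mem_univ t)]
    · rw [Matrix.smul_mulVec, outer_mulVec, real_inner_self_eq_norm_sq, v.norm_eq_one]
      simp
    · intro i _ hi
      rw [Matrix.smul_mulVec, outer_mulVec, v.orthonormal.2 hi]
      simp
  have hMS : M * (D * D.transpose) = 1 := by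
    rw [hD, dictMatrix_mul_transpose, h, Matrix.mul_sum, ← sum_outer_orthonormalBasis v]
    refine Finset.sum_congr rfl fun t _ => ?_
    rw [Matrix.mul_smul, outer, Matrix.mul_vecMulVec, hMv, Matrix.smul_vecMulVec, smul_smul,
      mul_inv_cancel₀ (hlam t).ne', one_smul]
  have hSM : D * D.transpose * M = 1 := mul_eq_one_comm.1 hMS
  have hDP : D * (D.transpose * M) = 1 := by rw [← Matrix.mul_assoc, hSM]
  have hrep : ∀ a, ∑ i, matScheme (D.transpose * M) a i • d i = a := fun a => by
    have h1 := dictMatrix_mulVec d (matScheme (D.transpose * M) a)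
    rw [matScheme, Matrix.mulVec_mulVec, hDP, Matrix.one_mulVec] at h1
    exact (WithLp.ofLp_injective 2 h1).symm
  have hinner : ∀ (y : EuclideanSpace ℝ (Fin K)) a,
      inner ℝ y (matScheme (D.transpose * M) a) = (∑ i, y i • d i).ofLp ⬝ᵥ M.mulVec a.ofLp := by
    intro y a
    rw [inner_eq_dotProduct, matScheme, ← Matrix.mulVec_mulVec, Matrix.dotProduct_mulVec,
      Matrix.vecMul_transpose, hD, dictMatrix_mulVec]
  refine ⟨D.transpose * M, ⟨?_, ?_, ?_, ?_⟩, hrep, fun a => ?_, fun a y hy => ?_⟩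
  · rw [hDP, Matrix.one_mul]
  · rw [Matrix.mul_assoc, hDP, Matrix.mul_one]
  · rw [hDP, Matrix.transpose_one]
  · rw [Matrix.transpose_mul, Matrix.transpose_mul, hMT, Matrix.transpose_transpose,
      Matrix.mul_assoc]
  · rw [hinner, hrep, hM, dotProduct_sum_outer]
    simp only [sq]
  · have h2 : inner ℝ (y - matScheme (D.transpose * M) a) (matScheme (D.transpose * M) a) =
        (0 : ℝ) := by
      rw [inner_sub_left, hinner, hinner, hy, hrep, sub_self]
    set p := matScheme (D.transpose * M) a
    have h3 : y = (y - p) + p := by abel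
    conv_lhs => rw [h3]
    rw [inner_add_left, inner_add_right, inner_add_right, real_inner_comm (y - p) p, h2]
    ring

end Matrices


/-! ### Moments and costs -/

section Moments

variable {Ω : Type*} [MeasurableSpace Ω] {μ : Measure Ω} {n K : ℕ}
  {V : Ω → EuclideanSpace ℝ (Fin n)}

theorem integrable_inner_sq (hV : MemLp V 2 μ) (a : EuclideanSpace ℝ (Fin n)) :
    Integrable (fun ω => (inner ℝ a (V ω) : ℝ) ^ 2) μ :=
  (hV.const_inner a).integrable_sq

theorem integral_inner_sq (hV : MemLp V 2 μ) (a : EuclideanSpace ℝ (Fin n)) :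
    ∫ ω, (inner ℝ a (V ω) : ℝ) ^ 2 ∂μ = a.ofLp ⬝ᵥ (secondMoment μ V).mulVec a.ofLp := by
  have hi : ∀ i, MemLp (fun ω => V ω i) 2 μ := fun i => by
    simpa [EuclideanSpace.inner_single_left] using
      MemLp.const_inner (𝕜 := ℝ) (EuclideanSpace.single i (1 : ℝ)) hV
  have hij : ∀ i j, Integrable (fun ω => V ω i * V ω j) μ := fun i j =>
    (hi i).integrable_mul (hi j)
  have h1 : ∀ ω, (inner ℝ a (V ω) : ℝ) ^ 2 = ∑ i, ∑ j, a i * a j * (V ω i * V ω j) := fun ω => by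
    rw [inner_eq_dotProduct, sq, dotProduct, Finset.sum_mul_sum]
    exact Finset.sum_congr rfl fun i _ => Finset.sum_congr rfl fun j _ => by ring
  simp only [h1]
  rw [integral_finsetSum _ fun i _ => integrable_finsetSum _ fun j _ => (hij i j).const_mul _]
  simp only [dotProduct, Matrix.mulVec, Finset.mul_sum]
  refine Finset.sum_congr rfl fun i _ => ?_
  rw [integral_finsetSum _ fun j _ => (hij i j).const_mul _]
  refine Finset.sum_congr rfl fun j _ => ?_
  rw [integral_const_mul, secondMoment, Matrix.of_apply]
  ring

theorem integral_inner_sq_eq_sum (hV : MemLp V 2 μ)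
    (u : OrthonormalBasis (Fin n) ℝ (EuclideanSpace ℝ (Fin n))) {s : Fin n → ℝ}
    (hu : ∀ i, (secondMoment μ V).mulVec (u i).ofLp = s i • (u i).ofLp)
    (a : EuclideanSpace ℝ (Fin n)) :
    ∫ ω, (inner ℝ a (V ω) : ℝ) ^ 2 ∂μ = ∑ i, s i * (inner ℝ (u i) a) ^ 2 := by
  rw [integral_inner_sq hV, eq_sum_outer u hu, dotProduct_sum_outer]
  simp only [sq]

/-- A zero eigenvalue would give `⟨a, V⟩ = 0` almost surely, so the closed hyperplane orthogonal to
`a` would contain the support and its span. -/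
theorem eigenvalue_pos (hV : MemLp V 2 μ)
    (hspan : Submodule.span ℝ (μ.map V).support = ⊤) {a : EuclideanSpace ℝ (Fin n)} (ha : a ≠ 0)
    {r : ℝ} (hr : (secondMoment μ V).mulVec a.ofLp = r • a.ofLp) : 0 < r := by
  have hVm : AEMeasurable V μ := hV.1.aemeasurable
  have h1 := integral_inner_sq hV a
  rw [hr, dotProduct_smul, ← inner_eq_dotProduct, real_inner_self_eq_norm_sq, smul_eq_mul] at h1
  have hna : 0 < ‖a‖ ^ 2 := by positivity
  have hnn : 0 ≤ ∫ ω, (inner ℝ a (V ω) : ℝ) ^ 2 ∂μ := integral_nonneg fun _ => sq_nonneg _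
  refine lt_of_le_of_ne (nonneg_of_mul_nonneg_left (h1 ▸ hnn) hna) fun h0 => ha ?_
  rw [← h0, zero_mul, integral_eq_zero_iff_of_nonneg (fun _ => sq_nonneg _)
    (integrable_inner_sq hV a)] at h1
  have hcl : IsClosed {y : EuclideanSpace ℝ (Fin n) | inner ℝ a y = 0} :=
    isClosed_eq (by fun_prop) continuous_const
  have hae : {y : EuclideanSpace ℝ (Fin n) | inner ℝ a y = 0} ∈ ae (μ.map V) := by
    refine (ae_map_iff hVm hcl.measurableSet).2 ?_
    filter_upwards [h1] with ω hω
    exact pow_eq_zero_iff two_ne_zero |>.1 hω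
  have hsub := Measure.support_subset_of_isClosed hcl hae
  have hle : Submodule.span ℝ (μ.map V).support ≤ (ℝ ∙ a)ᗮ :=
    Submodule.span_le.2 fun y hy => Submodule.mem_orthogonal_singleton_iff_inner_right.2 (hsub hy)
  rw [hspan] at hle
  have := Submodule.mem_orthogonal_singleton_iff_inner_right.1 (hle (Submodule.mem_top (x := a)))
  exact inner_self_eq_zero.1 this

theorem continuous_matScheme (P : Matrix (Fin K) (Fin n) ℝ) : Continuous (matScheme P) := by
  unfold matScheme
  exact (PiLp.continuous_toLp 2 _).comp
    (Continuous.matrix_mulVec continuous_const (PiLp.continuous_ofLp 2 _))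

theorem cost_matScheme (hV : MemLp V 2 μ)
    (u v : OrthonormalBasis (Fin n) ℝ (EuclideanSpace ℝ (Fin n))) {s lam : Fin n → ℝ}
    (hu : ∀ i, (secondMoment μ V).mulVec (u i).ofLp = s i • (u i).ofLp) (hlam : ∀ t, 0 < lam t)
    {P : Matrix (Fin K) (Fin n) ℝ} (hP : ∀ a, inner ℝ (matScheme P a) (matScheme P a) =
        ∑ t, (lam t)⁻¹ * (inner ℝ (v t) a) ^ 2) :
    cost μ V (matScheme P) =
      ENNReal.ofReal (∑ t, (lam t)⁻¹ * ∑ i, s i * (inner ℝ (u i) (v t)) ^ 2) := by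
  have hint : ∀ t, Integrable (fun ω => (lam t)⁻¹ * (inner ℝ (v t) (V ω) : ℝ) ^ 2) μ := fun t =>
    (integrable_inner_sq hV (v t)).const_mul _
  simp only [cost, hP]
  rw [← ofReal_integral_eq_lintegral_ofReal (integrable_finsetSum _ fun t _ => hint t)
    (Filter.Eventually.of_forall fun ω => Finset.sum_nonneg fun t _ =>
      mul_nonneg (inv_nonneg.2 (hlam t).le) (sq_nonneg _)),
    integral_finsetSum _ fun t _ => hint t]
  simp only [integral_const_mul, integral_inner_sq_eq_sum hV u hu]

theorem cost_eq_add (hV : MemLp V 2 μ) {d : Fin K → EuclideanSpace ℝ (Fin n)}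
    {f : EuclideanSpace ℝ (Fin n) → EuclideanSpace ℝ (Fin K)}
    (hf : ∀ᵐ ω ∂μ, ∑ i, f (V ω) i • d i = V ω)
    {P : Matrix (Fin K) (Fin n) ℝ}
    (hP : ∀ (a : EuclideanSpace ℝ (Fin n)) (y : EuclideanSpace ℝ (Fin K)), ∑ i, y i • d i = a →
        inner ℝ y y = (inner ℝ (matScheme P a) (matScheme P a) : ℝ) +
          inner ℝ (y - matScheme P a) (y - matScheme P a)) :
    cost μ V f = cost μ V (matScheme P) +
      ∫⁻ ω, ENNReal.ofReal (inner ℝ (f (V ω) - matScheme P (V ω))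
        (f (V ω) - matScheme P (V ω))) ∂μ := by
  have hm : AEMeasurable (fun ω => matScheme P (V ω)) μ :=
    (continuous_matScheme P).measurable.comp_aemeasurable hV.1.aemeasurable
  rw [cost, cost, ← lintegral_add_left' (hm.inner hm).ennreal_ofReal]
  refine lintegral_congr_ae ?_
  filter_upwards [hf] with ω hω
  rw [hP _ _ hω, ENNReal.ofReal_add real_inner_self_nonneg real_inner_self_nonneg]

/-- The excess cost is the mean square deviation from the pseudo-inverse scheme; cancelling the
finite cost of that scheme makes it zero. -/
theorem ae_eq_of_cost_le (hV : MemLp V 2 μ) {d : Fin K → EuclideanSpace ℝ (Fin n)}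
    {f : EuclideanSpace ℝ (Fin n) → EuclideanSpace ℝ (Fin K)}
    (hfm : AEMeasurable f (μ.map V)) (hf : ∀ᵐ ω ∂μ, ∑ i, f (V ω) i • d i = V ω)
    {P : Matrix (Fin K) (Fin n) ℝ}
    (hP : ∀ (a : EuclideanSpace ℝ (Fin n)) (y : EuclideanSpace ℝ (Fin K)), ∑ i, y i • d i = a →
        inner ℝ y y = (inner ℝ (matScheme P a) (matScheme P a) : ℝ) +
          inner ℝ (y - matScheme P a) (y - matScheme P a))
    (htop : cost μ V (matScheme P) ≠ ⊤) (hle : cost μ V f ≤ cost μ V (matScheme P)) :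
    ∀ᵐ ω ∂μ, f (V ω) = matScheme P (V ω) := by
  have hm : AEMeasurable (fun ω => f (V ω) - matScheme P (V ω)) μ :=
    (hfm.comp_aemeasurable hV.1.aemeasurable).sub
      ((continuous_matScheme P).measurable.comp_aemeasurable hV.1.aemeasurable)
  rw [cost_eq_add hV hf hP] at hle
  have h0 : ∫⁻ ω, ENNReal.ofReal (inner ℝ (f (V ω) - matScheme P (V ω))
        (f (V ω) - matScheme P (V ω))) ∂μ = 0 := by
    refine nonpos_iff_eq_zero.1 ?_
    exact (ENNReal.add_le_add_iff_left htop).1 (by rwa [add_zero])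
  rw [lintegral_eq_zero_iff' (hm.inner hm).ennreal_ofReal] at h0
  filter_upwards [h0] with ω hω
  have h1 : (inner ℝ (f (V ω) - matScheme P (V ω)) (f (V ω) - matScheme P (V ω)) : ℝ) ≤ 0 :=
    ENNReal.ofReal_eq_zero.1 hω
  exact sub_eq_zero.1 (inner_self_eq_zero.1 (le_antisymm h1 real_inner_self_nonneg))

theorem exists_eigenbasis_secondMoment (μ : Measure Ω) (V : Ω → EuclideanSpace ℝ (Fin n)) :
    ∃ u : OrthonormalBasis (Fin n) ℝ (EuclideanSpace ℝ (Fin n)), ∀ i,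
      (secondMoment μ V).mulVec (u i).ofLp = sigmaEig μ V i • (u i).ofLp :=
  exists_eigenbasis (secondMoment_isHermitian μ V)

theorem sigmaEig_antitone (μ : Measure Ω) (V : Ω → EuclideanSpace ℝ (Fin n)) :
    Antitone (sigmaEig μ V) := fun i j hij =>
  (secondMoment_isHermitian μ V).eigenvalues₀_antitone (by simpa using hij)

theorem sigmaEig_pos (hV : MemLp V 2 μ)
    (hspan : Submodule.span ℝ (μ.map V).support = ⊤) (i : Fin n) : 0 < sigmaEig μ V i := by
  obtain ⟨u, hu⟩ := exists_eigenbasis_secondMoment μ V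
  refine eigenvalue_pos hV hspan (fun h => ?_) (hu i)
  have := u.norm_eq_one i
  rw [h, norm_zero] at this
  exact zero_ne_one this

end Moments

/-! ### Optimal dictionaries -/

section Optimal

variable {Ω : Type*} [MeasurableSpace Ω] {μ : Measure Ω} {n K : ℕ}
  {V : Ω → EuclideanSpace ℝ (Fin n)} {ℓ : Fin K → ℝ} {x : Fin n → ℝ}

theorem tail_le_tail_foldedLengths (hnK : n ≤ K) {d : Fin K → EuclideanSpace ℝ (Fin n)}
    (hd : IsDictionary ℓ d) (v : OrthonormalBasis (Fin n) ℝ (EuclideanSpace ℝ (Fin n)))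
    {lam : Fin n → ℝ} (hlam : Antitone lam) (h : ∑ i, outer (d i) = ∑ t, lam t • outer (v t))
    (k : ℕ) : ∑ t with k ≤ (t : Fin n).val, lam t ≤
      ∑ t with k ≤ (t : Fin n).val, foldedLengths hnK ℓ t := by
  rcases lt_or_ge k n with hk | hk
  · rw [tail_foldedLengths hnK ℓ hk]
    have := tail_le_of_frame hk.le v hlam (sum_sq_of_sum_outer_eq h)
    simpa only [hd _] using this
  · rw [tail_eq_zero _ hk, tail_eq_zero _ hk]

theorem IsFeasible.ofReal_le_cost (hnK : n ≤ K) (hV : MemLp V 2 μ)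
    (hspan : Submodule.span ℝ (μ.map V).support = ⊤)
    (hx : IsQPSolution (foldedLengths hnK ℓ) (sigmaEig μ V) x) (hpos : ∀ t, 0 < x t)
    {d : Fin K → EuclideanSpace ℝ (Fin n)}
    {f : EuclideanSpace ℝ (Fin n) → EuclideanSpace ℝ (Fin K)} (hf : IsFeasible μ V ℓ d f) :
    ENNReal.ofReal (∑ t, √(sigmaEig μ V t) * x t) ≤ cost μ V f := by
  obtain ⟨u, hu⟩ := exists_eigenbasis_secondMoment μ V
  obtain ⟨v, lam, hanti, hlam, h⟩ := exists_sum_outer_eq hf.span_eq_top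
  obtain ⟨P, -, -, hP1, hP2⟩ := exists_pseudoInverse v hlam h
  rw [cost_eq_add hV hf.represents hP2, cost_matScheme hV u v hu hlam hP1]
  refine le_add_right (ENNReal.ofReal_le_ofReal ?_)
  exact le_trace (fun t => (sigmaEig_pos hV hspan t).le) (sigmaEig_antitone μ V) hlam hpos hx
    (tail_le_tail_foldedLengths hnK hf.lengths v hanti h)

theorem IsFeasible.exists_of_cost_le (hnK : n ≤ K) (hV : MemLp V 2 μ)
    (hspan : Submodule.span ℝ (μ.map V).support = ⊤)
    (hx : IsQPSolution (foldedLengths hnK ℓ) (sigmaEig μ V) x) (hpos : ∀ t, 0 < x t)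
    {d : Fin K → EuclideanSpace ℝ (Fin n)}
    {f : EuclideanSpace ℝ (Fin n) → EuclideanSpace ℝ (Fin K)} (hf : IsFeasible μ V ℓ d f)
    (hle : cost μ V f ≤ ENNReal.ofReal (∑ t, √(sigmaEig μ V t) * x t)) :
    ∃ v : OrthonormalBasis (Fin n) ℝ (EuclideanSpace ℝ (Fin n)),
      (∀ t, (secondMoment μ V).mulVec (v t).ofLp = sigmaEig μ V t • (v t).ofLp) ∧
      ∑ i, outer (d i) = ∑ t, (√(sigmaEig μ V t) / x t) • outer (v t) := by
  obtain ⟨u, hu⟩ := exists_eigenbasis_secondMoment μ V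
  obtain ⟨v, lam, hanti, hlam, h⟩ := exists_sum_outer_eq hf.span_eq_top
  obtain ⟨P, -, -, hP1, hP2⟩ := exists_pseudoInverse v hlam h
  rw [cost_eq_add hV hf.represents hP2, cost_matScheme hV u v hu hlam hP1] at hle
  have hle' := (ENNReal.ofReal_le_ofReal_iff (Finset.sum_nonneg fun t _ =>
    mul_nonneg (Real.sqrt_nonneg _) (hpos t).le)).1 (le_self_add.trans hle)
  obtain ⟨h1, h2⟩ := eq_of_trace_le (fun t => (sigmaEig_pos hV hspan t).le)
    (sigmaEig_antitone μ V) hlam hanti hpos hx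
    (tail_le_tail_foldedLengths hnK hf.lengths v hanti h) hle'
  refine ⟨v, fun t => ?_, by simpa only [h1] using h⟩
  -- By the equality case, `v t` expands only in eigenvectors `u i` with eigenvalue equal to the
  -- `t`-th one.
  have h3 : (v t).ofLp = ∑ i, (inner ℝ (u i) (v t) : ℝ) • (u i).ofLp := by
    rw [← WithLp.ofLp_sum 2]
    conv_lhs => rw [← u.sum_repr' (v t)]
    simp
  rw [h3, Matrix.mulVec_sum, Finset.smul_sum]
  refine Finset.sum_congr rfl fun i _ => ?_
  rw [Matrix.mulVec_smul, hu]
  rcases h2 i t with h | h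
  · simp [h]
  · rw [h, smul_comm]

theorem exists_optimal_pseudoInverse (hnK : n ≤ K) (hV : MemLp V 2 μ)
    (hspan : Submodule.span ℝ (μ.map V).support = ⊤)
    (hx : IsQPSolution (foldedLengths hnK ℓ) (sigmaEig μ V) x) (hpos : ∀ t, 0 < x t)
    {d : Fin K → EuclideanSpace ℝ (Fin n)} (hd : IsDictionary ℓ d)
    (v : OrthonormalBasis (Fin n) ℝ (EuclideanSpace ℝ (Fin n)))
    (hv : ∀ t, (secondMoment μ V).mulVec (v t).ofLp = sigmaEig μ V t • (v t).ofLp)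
    (h : ∑ i, outer (d i) = ∑ t, (√(sigmaEig μ V t) / x t) • outer (v t)) :
    ∃ P : Matrix (Fin K) (Fin n) ℝ, IsPseudoInverse (dictMatrix d) P ∧
      IsOptimal μ V ℓ d (matScheme P) ∧
      cost μ V (matScheme P) = ENNReal.ofReal (∑ t, √(sigmaEig μ V t) * x t) ∧
      ∀ f, IsOptimal μ V ℓ d f → ∀ᵐ ω ∂μ, f (V ω) = matScheme P (V ω) := by
  have hlam : ∀ t, 0 < √(sigmaEig μ V t) / x t := fun t =>
    div_pos (Real.sqrt_pos.2 (sigmaEig_pos hV hspan t)) (hpos t)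
  obtain ⟨P, hP0, hrep, hP1, hP2⟩ := exists_pseudoInverse v hlam h
  have hfeas : IsFeasible μ V ℓ d (matScheme P) :=
    ⟨hd, span_eq_top_of_sum_outer_eq v hlam h, (continuous_matScheme P).measurable.aemeasurable,
      Filter.Eventually.of_forall fun ω => hrep _⟩
  have hcost : cost μ V (matScheme P) = ENNReal.ofReal (∑ t, √(sigmaEig μ V t) * x t) := by
    -- Using `v` as eigenbasis of both operators kills the cross terms and leaves `σₜ / λₜ = √σₜ *
    -- xₜ`.
    rw [cost_matScheme hV v v hv hlam hP1]
    congr 1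
    refine Finset.sum_congr rfl fun t _ => ?_
    rw [Finset.sum_eq_single_of_mem t (Finset.mem_univ t) fun i _ hi => by
      rw [v.orthonormal.2 hi]; simp, real_inner_self_eq_norm_sq, v.norm_eq_one]
    have h1 := Real.sqrt_pos.2 (sigmaEig_pos hV hspan t)
    have h2 := Real.sq_sqrt (sigmaEig_pos hV hspan t).le
    have h3 := hpos t
    field_simp
    rw [h2]
  refine ⟨P, hP0, ⟨hfeas, fun d' f' hf' => ?_⟩, hcost, fun f hf => ?_⟩
  · rw [hcost]
    exact hf'.ofReal_le_cost hnK hV hspan hx hpos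
  · exact ae_eq_of_cost_le hV hf.1.aemeasurable hf.1.represents hP2
      (by rw [hcost]; exact ENNReal.ofReal_ne_top) (hf.2 _ _ hfeas)

theorem sum_dite_lt {M : Type*} [AddCommMonoid M] (hnK : n ≤ K) (f : Fin n → M) :
    (∑ i : Fin K, if h : i.val < n then f ⟨i.val, h⟩ else 0) = ∑ t, f t := by
  obtain ⟨r, rfl⟩ := Nat.exists_eq_add_of_le hnK
  rw [Fin.sum_univ_add]
  simp

theorem exists_dictionary (hn : 0 < n) (hnK : n ≤ K) (hℓpos : ∀ i, 0 < ℓ i) (hℓanti : Antitone ℓ)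
    {lam : Fin n → ℝ} (hlam : ∀ t, 0 < lam t)
    (htail : ∀ k : ℕ, ∑ t with k ≤ (t : Fin n).val, lam t ≤
      ∑ t with k ≤ (t : Fin n).val, foldedLengths hnK ℓ t)
    (htot : ∑ t, lam t = ∑ t, foldedLengths hnK ℓ t)
    (u : OrthonormalBasis (Fin n) ℝ (EuclideanSpace ℝ (Fin n))) :
    ∃ d : Fin K → EuclideanSpace ℝ (Fin n), IsDictionary ℓ d ∧
      ∑ i, outer (d i) = ∑ t, lam t • outer (u t) := by
  -- Orthogonal vectors `√λₜ uₜ` padded by zeros already have the desired frame operator; rotations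
  -- then correct the norms.
  set d₀ : Fin K → EuclideanSpace ℝ (Fin n) := fun i =>
    if h : i.val < n then √(lam ⟨i.val, h⟩) • u ⟨i.val, h⟩ else 0 with hd₀
  have hB : ∀ x y, ∑ i, inner ℝ (d₀ i) x * inner ℝ (d₀ i) y =
      ∑ t, lam t * (inner ℝ (u t) x * inner ℝ (u t) y) := fun x y => by
    rw [← sum_dite_lt hnK]
    refine Finset.sum_congr rfl fun i _ => ?_
    simp only [hd₀]
    split_ifs with h
    · rw [inner_smul_left, inner_smul_left, conj_trivial]
      linear_combination (inner ℝ (u ⟨i, h⟩) x * inner ℝ (u ⟨i, h⟩) y : ℝ) *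
        Real.mul_self_sqrt (hlam ⟨i, h⟩).le
    · simp
  have hnorm : ∀ i, (inner ℝ (d₀ i) (d₀ i) : ℝ) = if h : i.val < n then lam ⟨i.val, h⟩ else 0 := by
    intro i
    simp only [hd₀]
    split_ifs with h
    · rw [inner_smul_left, inner_smul_right, real_inner_self_eq_norm_sq, u.norm_eq_one,
        conj_trivial, one_pow, mul_one, Real.mul_self_sqrt (hlam _).le]
    · simp
  have htail₀ : ∀ k : ℕ, ∑ i with k ≤ (i : Fin K).val, inner ℝ (d₀ i) (d₀ i) ≤
      ∑ i with k ≤ (i : Fin K).val, ℓ i := by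
    intro k
    have h1 : ∑ i with k ≤ (i : Fin K).val, (inner ℝ (d₀ i) (d₀ i) : ℝ) =
        ∑ t with k ≤ (t : Fin n).val, lam t := by
      rw [Finset.sum_filter, Finset.sum_filter, ← sum_dite_lt hnK]
      refine Finset.sum_congr rfl fun i _ => ?_
      rw [hnorm]
      split_ifs <;> rfl
    rw [h1]
    rcases lt_or_ge k n with hk | hk
    · rw [← tail_foldedLengths hnK ℓ hk]
      exact htail k
    · rw [tail_eq_zero _ hk]
      exact Finset.sum_nonneg fun i _ => (hℓpos i).le
  have htot₀ : ∑ i, inner ℝ (d₀ i) (d₀ i) = ∑ i, ℓ i := by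
    simp only [hnorm]
    rw [sum_dite_lt hnK, htot, sum_foldedLengths hn]
  obtain ⟨d, hd, hdB⟩ := exists_frame_of_majorized hℓanti d₀ htail₀ htot₀
  exact ⟨d, hd, sum_outer_eq_iff.2 fun x y => (hdB x y).trans (hB x y)⟩

theorem exists_orthonormalBasis_eq {u : Fin n → EuclideanSpace ℝ (Fin n)}
    (hu : Orthonormal ℝ u) :
    ∃ v : OrthonormalBasis (Fin n) ℝ (EuclideanSpace ℝ (Fin n)), ⇑v = u :=
  ⟨OrthonormalBasis.mk hu (hu.linearIndependent.span_eq_top_of_card_eq_finrank' (by simp)).ge,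
    OrthonormalBasis.coe_mk _ _⟩

end Optimal

end L2Dict

/-! ### The main theorem -/

theorem theorem1 {Ω : Type*} [MeasurableSpace Ω] (μ : Measure Ω) [IsProbabilityMeasure μ]
    {n K : ℕ} (hn : 0 < n) (hnK : n ≤ K)
    (V : Ω → EuclideanSpace ℝ (Fin n)) (hV : MemLp V 2 μ)
    (hspan : Submodule.span ℝ (μ.map V).support = ⊤)
    (ℓ : Fin K → ℝ) (hℓpos : ∀ i, 0 < ℓ i) (hℓanti : Antitone ℓ) :
    ∃ x : Fin n → ℝ,
      -- the quadratic program has the unique optimal solution `x`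
      (∀ y : Fin n → ℝ,
        L2Dict.IsQPSolution (L2Dict.foldedLengths hnK ℓ) (L2Dict.sigmaEig μ V) y ↔ y = x) ∧
      let ℓ' : Fin n → ℝ := L2Dict.foldedLengths hnK ℓ
      let σ : Fin n → ℝ := L2Dict.sigmaEig μ V
      let q : ℝ := L2Dict.qpObjective ℓ' σ x
      let T : ℕ := L2Dict.numBlocks x
      let p : ℕ → ℕ := L2Dict.breakSeq x
      let lam : Fin n → ℝ := L2Dict.lambdaMap (fun i => √(σ i)) ℓ' T p
      let J : ℝ := L2Dict.JMap (fun i => √(σ i)) ℓ' T p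
      -- `λ*` is a non-increasing sequence of positive reals
      ((∀ i, 0 < lam i) ∧ Antitone lam) ∧
      -- an optimal solution exists
      (∃ d f, L2Dict.IsOptimal μ V ℓ d f) ∧
      -- characterisation of the optimal dictionaries
      (∀ d : Fin K → EuclideanSpace ℝ (Fin n), L2Dict.IsDictionary ℓ d →
        (L2Dict.IsOptimalDictionary μ V ℓ d ↔
          ∃ u : Fin n → EuclideanSpace ℝ (Fin n), Orthonormal ℝ u ∧
            (∀ i, (L2Dict.secondMoment μ V).mulVec (u i).ofLp = σ i • (u i).ofLp) ∧
            ∑ i, L2Dict.outer (d i) = ∑ i, lam i • L2Dict.outer (u i))) ∧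
      -- the optimal scheme of an optimal dictionary is its pseudo-inverse, almost surely unique
      (∀ d : Fin K → EuclideanSpace ℝ (Fin n), L2Dict.IsOptimalDictionary μ V ℓ d →
        ∃ P : Matrix (Fin K) (Fin n) ℝ, L2Dict.IsPseudoInverse (L2Dict.dictMatrix d) P ∧
          L2Dict.IsOptimal μ V ℓ d (L2Dict.matScheme P) ∧
          ∀ f, L2Dict.IsOptimal μ V ℓ d f →
            ∀ᵐ ω ∂μ, f (V ω) = L2Dict.matScheme P (V ω)) ∧
      -- the optimal value
      (sInf (L2Dict.feasibleCosts μ V ℓ) = ENNReal.ofReal J ∧ J = -q) := by 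
  have ha := fun t => L2Dict.foldedLengths_pos hnK hℓpos t
  have hs := L2Dict.sigmaEig_pos hV hspan
  obtain ⟨x, hx⟩ := L2Dict.exists_isQPSolution (s := L2Dict.sigmaEig μ V) ha
  have hpos := hx.pos ha hs
  have hlam := hx.lambdaMap_eq ha hpos
  have hlampos : ∀ t, 0 < √(L2Dict.sigmaEig μ V t) / x t := fun t =>
    div_pos (Real.sqrt_pos.2 (hs t)) (hpos t)
  obtain ⟨u, hu⟩ := L2Dict.exists_eigenbasis_secondMoment μ V
  obtain ⟨d₀, hd₀, hd₀u⟩ := L2Dict.exists_dictionary hn hnK hℓpos hℓanti hlampos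
    (hx.tail_le hpos) (hx.total_eq hpos) u
  obtain ⟨P₀, -, hopt₀, hcost₀, -⟩ :=
    L2Dict.exists_optimal_pseudoInverse hnK hV hspan hx hpos hd₀ u hu hd₀u
  -- The constructed pair `(d₀, P₀)` attains the lower bound, so every optimal pair does and falls
  -- under the equality case.
  have hnec : ∀ d, L2Dict.IsOptimalDictionary μ V ℓ d →
      ∃ v : OrthonormalBasis (Fin n) ℝ (EuclideanSpace ℝ (Fin n)),
        (∀ t, (L2Dict.secondMoment μ V).mulVec (v t).ofLp =
          L2Dict.sigmaEig μ V t • (v t).ofLp) ∧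
        ∑ i, L2Dict.outer (d i) =
          ∑ t, (√(L2Dict.sigmaEig μ V t) / x t) • L2Dict.outer (v t) := by
    rintro d ⟨f, hf⟩
    exact hf.1.exists_of_cost_le hnK hV hspan hx hpos (hcost₀ ▸ hf.2 _ _ hopt₀.1)
  refine ⟨x, fun y => ⟨fun hy => hx.unique ha hy, fun hy => hy ▸ hx⟩, ?_⟩
  dsimp only
  simp only [hlam, hx.JMap_eq ha hpos]
  refine ⟨⟨hlampos, fun i j hij => ?_⟩, ⟨d₀, _, hopt₀⟩, fun d hd => ⟨fun h => ?_, ?_⟩,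
    fun d hd => ?_, ?_, ?_⟩
  · rw [hlam, hlam]
    exact div_le_div₀ (Real.sqrt_nonneg _)
      (Real.sqrt_le_sqrt (L2Dict.sigmaEig_antitone μ V hij)) (hpos i) (hx.1.2 hij)
  · obtain ⟨v, hv, hdv⟩ := hnec d h
    exact ⟨v, v.orthonormal, hv, hdv⟩
  · rintro ⟨w, hw, hwe, hdw⟩
    obtain ⟨v, rfl⟩ := L2Dict.exists_orthonormalBasis_eq hw
    obtain ⟨P, -, hopt, -⟩ :=
      L2Dict.exists_optimal_pseudoInverse hnK hV hspan hx hpos hd v hwe hdw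
    exact ⟨_, hopt⟩
  · obtain ⟨v, hv, hdv⟩ := hnec d hd
    obtain ⟨f, hf⟩ := hd
    obtain ⟨P, hP, hopt, -, huniq⟩ :=
      L2Dict.exists_optimal_pseudoInverse hnK hV hspan hx hpos hf.1.lengths v hv hdv
    exact ⟨P, hP, hopt, huniq⟩
  · refine le_antisymm (sInf_le ⟨d₀, _, hopt₀.1, hcost₀⟩) (le_sInf ?_)
    rintro r ⟨d, f, hf, rfl⟩
    exact hf.ofReal_le_cost hnK hV hspan hx hpos
  · rw [hx.qpObjective_eq hpos, neg_neg]
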